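/- **Conventions.** Let $E,F$ be (complete) Hilbert C$^*$-modules over a C$^*$-algebra $A$. $\mathcal L(E,F)$ denotes the adjointable operators from $E$ to $F$, and $\mathcal L(E)=\mathcal L(E,E)$. Operators written without further comment may be unbounded; they are composed on maximal domains, and $P\subseteq Q$ means that $Q$ extends $P$. * For a densely defined $A$-linear $T$ from within $E$ into $F$, $D(T^*)$ is the set of $v\in F$ for which there is $w\in E$ with $\langle Tu,v\rangle=\langle u,w\rangle$ for all $u\in D(T)$, and then $T^*v=w$. $T$ is *regular* if it is closed, $T^*$ is densely defined and $1+T^*T$ has dense range. A regular operator $T$ in $E$ is *normal* if $D(T)=D(T^*)$ and $\langle Tv,Tv\rangle=\langle T^*v,T^*v\rangle$ for $v\in D(T)$. A regular $T$ is *invertible* if it is injective and $T^{-1}$ is regular. The spectrum $\sigma(T)$ of a normal $T$ is the set of $c\in\mathbb C$ for which there is no $R\in\mathcal L(E)$ with $R(T-c1)\subseteq (T-c1)R=1$. The $z$-transform of a regular $T$ is the unique $z_T\in\mathcal L(E,F)$ with $\|z_T\|\le 1$, $D(T)=(1-z_T^*z_T)^{1/2}E$ and $T(1-z_T^*z_T)^{1/2}v=z_Tv$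 for all $v\in E$. * If $X$ is a locally compact space, $\pi:\mathrm C_0(X)\to\mathcal L(E)$ a non-degenerate $^*$-homomorphism and $f\in \mathrm C(X)$, then $\pi(f)$ is the regular operator in $E$ with $z$-transform $\pi\bigl(f/(1+|f|^2)^{1/2}\bigr)$, where $\pi$ is extended to bounded continuous functions by $\pi(h)\pi(g)=\pi(hg)$ for $g\in \mathrm C_0(X)$. * $G\subseteq\mathbb C$ is *almost closed* if $G\cup K$ is closed for some finite $K\subseteq\mathbb C$. $G$ is *compatible* with a normal $T$ if it is almost closed and there is a finite $K\subseteq\mathbb C$ such that $T-\lambda 1$ is invertible for every $\lambda\in K$ and $\sigma(T)\setminus K\subseteq G$. In this case, for continuous $f:G\to\mathbb C$, $f(T)$ denotes $\pi(f|_{\sigma(T)\setminus K})$, where $\pi:\mathrm C_0(\sigma(T)\setminus K)\to\mathcal L(E)$ is the non-degenerate $^*$-homomorphism such that $\pi$ of the identity function is $T$. **Theorem (Fuglede–Putnam for Hilbert C$^*$-modules).** Let $E,F$ be Hilbert C$^*$-modules over a C$^*$-algebra $A$, $U:E\to F$ a bounded ($\mathbb C$-)linear map, $S$ a normal regular operator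 in $E$ and $T$ a normal regular operator in $F$ such that $US\subseteq TU$. Then: 1. $US^*\subseteq T^*U$. 2. Let $G\subseteq\mathbb C$ be compatible with both $S$ and $T$, and let $f:G\to\mathbb C$ be continuous. Then $f(S)$ and $f(T)$ are well defined (they exist and do not depend on the choices of $K$ and $\pi$), and $Uf(S)\subseteq f(T)U$. 3. If, in the situation of 2, $U$ is moreover unitary (that is, $U\in\mathcal L(E,F)$ with $U^*U=1$ and $UU^*=1$), then $Uf(S)=f(T)U$. -/

import Mathlib

open scoped ZeroAtInfty

namespace HilbertModule

noncomputable section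

/-! ### Partially defined operators -/

section PartialMaps

variable {E F G : Type*} [NormedAddCommGroup E] [NormedSpace ℂ E]
  [NormedAddCommGroup F] [NormedSpace ℂ F] [NormedAddCommGroup G] [NormedSpace ℂ G]

/-- The composition `g f` of partially defined operators, on its maximal domain
`{x ∈ D(f) | f x ∈ D(g)}`. -/
def pcomp (g : F →ₗ.[ℂ] G) (f : E →ₗ.[ℂ] F) : E →ₗ.[ℂ] G :=
  g.comp (f.domRestrict ((g.domain.comap f.toFun).map f.domain.subtype)) (by
    rintro ⟨x, hx⟩
    obtain ⟨⟨y, hy, rfl⟩, h2⟩ := Submodule.mem_inf.mp hx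
    exact hy)

theorem mem_graph_pcomp (g : F →ₗ.[ℂ] G) (f : E →ₗ.[ℂ] F) (x : E) (z : G) :
    (x, z) ∈ (pcomp g f).graph ↔ ∃ y, (x, y) ∈ f.graph ∧ (y, z) ∈ g.graph := by
  simp only [LinearPMap.mem_graph_iff]
  constructor
  · rintro ⟨⟨w, hw⟩, rfl, rfl⟩
    obtain ⟨⟨y, hy, rfl⟩, h2⟩ := Submodule.mem_inf.mp hw
    exact ⟨f y, ⟨y, rfl, rfl⟩, ⟨f y, hy⟩, rfl, rfl⟩
  · rintro ⟨_, ⟨y, rfl, rfl⟩, ⟨w, hw⟩, hwy, rfl⟩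
    have hwy' : w = f y := hwy
    subst hwy'
    exact ⟨⟨y, Submodule.mem_inf.mpr ⟨⟨y, hw, rfl⟩, y.2⟩⟩, rfl, rfl⟩

/-- A bounded operator viewed as an everywhere defined partial operator. -/
def toP (U : E →L[ℂ] F) : E →ₗ.[ℂ] F := (U : E →ₗ[ℂ] F).toPMap ⊤

/-- The operator `T - c 1`, with domain `D(T)`. -/
def subScalar (T : E →ₗ.[ℂ] E) (c : ℂ) : E →ₗ.[ℂ] E :=
  T - toP (c • ContinuousLinearMap.id ℂ E)

end PartialMaps

/-! ### Adjointable and regular operators between Hilbert C⋆-modules -/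

section Operators

variable (A : Type*) [NonUnitalCStarAlgebra A] [PartialOrder A] [StarOrderedRing A]
  {E F : Type*}
  [NormedAddCommGroup E] [NormedSpace ℂ E] [SMul A E] [CStarModule A E]
  [NormedAddCommGroup F] [NormedSpace ℂ F] [SMul A F] [CStarModule A F]

/-- `s` is the adjoint of `t` with respect to the `A`-valued inner products. -/
def IsAdjointPair (t : E →L[ℂ] F) (s : F →L[ℂ] E) : Prop :=
  ∀ x y, inner A (t x) y = inner A x (s y)

/-- `t` belongs to `𝓛(E, F)`. -/
def IsAdjointable (t : E →L[ℂ] F) : Prop := ∃ s : F →L[ℂ] E, IsAdjointPair A t s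

/-- `U` is a unitary element of `𝓛(E, F)`. -/
def IsUnitary (U : E →L[ℂ] F) : Prop :=
  ∃ V : F →L[ℂ] E, IsAdjointPair A U V ∧
    V.comp U = ContinuousLinearMap.id ℂ E ∧ U.comp V = ContinuousLinearMap.id ℂ F

/-- `q` is a positive element of `𝓛(E)`. -/
def IsPositive (q : E →L[ℂ] E) : Prop :=
  IsAdjointPair A q q ∧ ∀ v, 0 ≤ inner A v (q v)

/-- The pairs `(v, w)` such that `⟨T u, v⟩ = ⟨u, w⟩` for every `u ∈ D(T)`. -/
def adjointGraph (T : E →ₗ.[ℂ] F) : Submodule ℂ (F × E) where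
  carrier := {p | ∀ u : T.domain, inner A (T u) p.1 = inner A (u : E) p.2}
  add_mem' := by
    intro p q hp hq u
    simp [hp u, hq u]
  zero_mem' := by
    intro u
    simp
  smul_mem' := by
    intro c p hp u
    simp [hp u]

/-- The adjoint `T⋆` of a densely defined operator. (The relation `adjointGraph A T` is the graph
of a function as soon as `D(T)` is dense, the only case in which this is used.) -/
def adjoint (T : E →ₗ.[ℂ] F) : F →ₗ.[ℂ] E := (adjointGraph A T).toLinearPMap

/-- `D(T)` is stable under the action of `A` and `T` commutes with this action. -/
def IsModuleMap (T : E →ₗ.[ℂ] F) : Prop :=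
  ∀ (a : A) (x : T.domain), ∃ h : a • (x : E) ∈ T.domain, T ⟨a • (x : E), h⟩ = a • T x

/-- `T` is a regular operator from within `E` into `F`. -/
structure IsRegular (T : E →ₗ.[ℂ] F) : Prop where
  dense_domain : Dense (T.domain : Set E)
  moduleMap : IsModuleMap A T
  closed : T.IsClosed
  dense_adjoint_domain : Dense ((adjoint A T).domain : Set F)
  dense_range :
    DenseRange (toP (ContinuousLinearMap.id ℂ E) + pcomp (adjoint A T) T).toFun

/-- `T` is a normal regular operator in `E`. -/
structure IsNormal (T : E →ₗ.[ℂ] E) : Prop where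
  regular : IsRegular A T
  domain_eq : T.domain = (adjoint A T).domain
  inner_eq : ∀ (v : T.domain) (w : (adjoint A T).domain), (v : E) = w →
    inner A (T v) (T v) = inner A (adjoint A T w) (adjoint A T w)

/-- `z` is the `z`-transform of `T`: `z ∈ 𝓛(E, F)`, `‖z‖ ≤ 1`, `D(T) = (1 - z⋆z)^{1/2} E` and
`T ((1 - z⋆z)^{1/2} v) = z v` for all `v`. Here `s = z⋆` and `q` is the positive square root of
`1 - z⋆z`; the last two conditions together say that the graph of `T` is `{(q v, z v) | v ∈ E}`. -/
def IsZTransform (T : E →ₗ.[ℂ] F) (z : E →L[ℂ] F) : Prop :=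
  ‖z‖ ≤ 1 ∧ ∃ (s : F →L[ℂ] E) (q : E →L[ℂ] E),
    IsAdjointPair A z s ∧ IsPositive A q ∧
    q.comp q = ContinuousLinearMap.id ℂ E - s.comp z ∧
    T.graph = LinearMap.range ((q : E →ₗ[ℂ] E).prod (z : E →ₗ[ℂ] F))

/-- `T` is invertible among regular operators: it is injective with regular inverse. -/
def IsInvertible (T : E →ₗ.[ℂ] F) : Prop :=
  Function.Injective T.toFun ∧ IsRegular A T.inverse

/-- `T` is adjointable invertible: there is `R ∈ 𝓛(F, E)` with `R T ⊆ T R = 1`. -/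
def IsAdjointableInvertible (T : E →ₗ.[ℂ] F) : Prop :=
  ∃ R : F →L[ℂ] E, IsAdjointable A R ∧
    pcomp (toP R) T ≤ toP (ContinuousLinearMap.id ℂ E) ∧
    pcomp T (toP R) = toP (ContinuousLinearMap.id ℂ F)

/-- The spectrum of `T`. -/
def spec (T : E →ₗ.[ℂ] E) : Set ℂ := {c | ¬ IsAdjointableInvertible A (subScalar T c)}

end Operators

/-! ### Functional calculus -/

section ZFunction

variable {X : Type*} [TopologicalSpace X]

/-- The function `f / (1 + |f|²)^{1/2}`: the `z`-transform of `f`, where `f ∈ C(X)` is regarded as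
an element affiliated with `C₀(X)`. -/
def zFun (f : C(X, ℂ)) : C(X, ℂ) where
  toFun x := f x / (√(1 + ‖f x‖ ^ 2) : ℝ)
  continuous_toFun := by
    refine f.continuous.div (by fun_prop) fun x => ?_
    have : 0 < √(1 + ‖f x‖ ^ 2) := by positivity
    exact_mod_cast this.ne'

theorem norm_zFun_le (f : C(X, ℂ)) (x : X) : ‖zFun f x‖ ≤ 1 := by
  have h : ‖f x‖ ≤ √(1 + ‖f x‖ ^ 2) := Real.le_sqrt_of_sq_le (by linarith)
  have h0 : 0 < √(1 + ‖f x‖ ^ 2) := by positivity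
  change ‖f x / ((√(1 + ‖f x‖ ^ 2) : ℝ) : ℂ)‖ ≤ 1
  rw [norm_div, Complex.norm_real, Real.norm_of_nonneg h0.le]
  exact (div_le_one h0).mpr h

/-- The product of the bounded function `zFun f` with an element of `C₀(X)`. -/
def zMul (f : C(X, ℂ)) (g : C₀(X, ℂ)) : C₀(X, ℂ) where
  toFun x := zFun f x * g x
  continuous_toFun := (zFun f).continuous.mul (map_continuous g)
  zero_at_infty' := by
    refine squeeze_zero_norm (fun x => ?_) (by simpa using (zero_at_infty g).norm)
    rw [norm_mul]
    exact mul_le_of_le_one_left (norm_nonneg _) (norm_zFun_le f x)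

end ZFunction

section Calculus

variable (A : Type*) [NonUnitalCStarAlgebra A] [PartialOrder A] [StarOrderedRing A]
  {E : Type*} [NormedAddCommGroup E] [NormedSpace ℂ E] [SMul A E] [CStarModule A E]

/-- `π` is a non-degenerate `⋆`-homomorphism from `C₀(X)` into `𝓛(E)`. -/
structure IsNondegenerateStarHom {X : Type*} [TopologicalSpace X]
    (π : C₀(X, ℂ) →ₙₐ[ℂ] (E →L[ℂ] E)) : Prop where
  adjoint : ∀ g, IsAdjointPair A (π g) (π (star g))
  nondegenerate :
    Dense (Submodule.span ℂ {y : E | ∃ (g : C₀(X, ℂ)) (v : E), π g v = y} : Set E)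

/-- `R = π(f)` for `f ∈ C(X)`: the regular operator whose `z`-transform is the value at `zFun f` of
the canonical extension of `π` to `M(C₀(X)) = C_b(X)`, i.e. the operator `z` with
`z π(g) = π(zFun f · g)` for all `g ∈ C₀(X)`. -/
def IsImage {X : Type*} [TopologicalSpace X] (π : C₀(X, ℂ) →ₙₐ[ℂ] (E →L[ℂ] E))
    (f : C(X, ℂ)) (R : E →ₗ.[ℂ] E) : Prop :=
  IsRegular A R ∧ ∃ z : E →L[ℂ] E, IsZTransform A R z ∧
    ∀ (g : C₀(X, ℂ)) (v : E), z (π g v) = π (zMul f g) v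

/-- `G` is almost closed: it becomes closed by adding finitely many points. -/
def IsAlmostClosed (G : Set ℂ) : Prop := ∃ K : Set ℂ, K.Finite ∧ IsClosed (G ∪ K)

/-- `G` is compatible with the normal operator `T`. -/
def IsCompatible (T : E →ₗ.[ℂ] E) (G : Set ℂ) : Prop :=
  IsAlmostClosed G ∧ ∃ K : Set ℂ, K.Finite ∧
    (∀ c ∈ K, IsInvertible A (subScalar T c)) ∧ spec A T \ K ⊆ G

/-- `R = f(T)` for a normal operator `T` and `f ∈ C(G)`: for some finite set `K` such that `T - c 1`
is invertible for every `c ∈ K` and such that `f` is defined on `σ(T) \ K`, and for a non-degenerate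
`⋆`-homomorphism `π : C₀(σ(T) \ K) → 𝓛(E)` sending the identity function of `σ(T) \ K` to `T`, the
operator `R` is `π` of the restriction of `f`. -/
def IsFunctionOf (T : E →ₗ.[ℂ] E) {G : Set ℂ} (f : C(G, ℂ)) (R : E →ₗ.[ℂ] E) : Prop :=
  ∃ K : Set ℂ, K.Finite ∧ (∀ c ∈ K, IsInvertible A (subScalar T c)) ∧
    ∃ (h : spec A T \ K ⊆ G)
      (π : C₀((spec A T \ K : Set ℂ), ℂ) →ₙₐ[ℂ] (E →L[ℂ] E)),
      IsNondegenerateStarHom A π ∧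
      IsImage A π ⟨fun x => (x : ℂ), continuous_subtype_val⟩ T ∧
      IsImage A π (f.comp ⟨Set.inclusion h, continuous_inclusion h⟩) R

end Calculus

end

end HilbertModule

/-!
A normal operator `S` is encoded by the bounded normal operator `z = z_S` and
`q = (1 - z⋆z)^{1/2}`: its graph is `{(q v, z v)}`. For `z`-transforms `z`, `z'` of `S`, `T`, the
hypothesis `US ⊆ TU` reads `q' U z = z' U q`. Cutting off near the zeros of `q` and `q'` turns the
quotients of `z` by `q` and of `z'` by `q'` into bounded normal operators, to which Rosenblum's
proof of the Fuglede–Putnam theorem applies; letting the cut-offs tend to `q` and `q'` gives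
`q' U z⋆ = z'⋆ U q`. It follows that `U` intertwines `q² = 1 - z⋆z` with `q'²`, hence `q` with `q'`
and `z` with `z'`.

The plane is mapped onto the open unit disc by `c ↦ c / (1 + |c|²)^{1/2}`, under which `σ(T)`
becomes the part of `σ(z)` inside the open disc. Let `h` be a continuous function on the closed
disc whose zeros are the boundary points and the points corresponding to the exceptional set `K`.
Then `h(z)` has dense range, so the `z`-transform `t` of `f(T)` is determined by
`t h(z) = (φ h)(z)`, where `φ` is `f / (1 + |f|²)^{1/2}` in the coordinate of the disc. All
operators in this equation except `t` are continuous functions of `z`. This gives the existence and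
the uniqueness of `f(T)`, and shows that `U` intertwines the `z`-transforms of `f(S)` and `f(T)`.
-/

namespace HilbertModule

open NormedSpace Topology
open scoped BoundedContinuousFunction ComplexOrder

noncomputable section

section Adjointable

variable {A : Type*} [NonUnitalCStarAlgebra A] [PartialOrder A] {E F : Type*}
  [NormedAddCommGroup E] [NormedSpace ℂ E] [SMul A E] [CStarModule A E]
  [NormedAddCommGroup F] [NormedSpace ℂ F] [SMul A F] [CStarModule A F]

variable (A) in
theorem ext_inner_left {x y : E} (h : ∀ w, inner A w x = inner A w y) : x = y := by
  rw [← sub_eq_zero, ← CStarModule.inner_self (A := A)]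
  simp [h]

theorem IsAdjointPair.symm {t : E →L[ℂ] F} {s : F →L[ℂ] E} (h : IsAdjointPair A t s) :
    IsAdjointPair A s t := fun x y => by
  rw [← CStarModule.star_inner y (s x), ← h, CStarModule.star_inner]

theorem IsAdjointPair.unique {t : E →L[ℂ] F} {s s' : F →L[ℂ] E} (h : IsAdjointPair A t s)
    (h' : IsAdjointPair A t s') : s = s' :=
  ContinuousLinearMap.ext fun y => ext_inner_left A fun w => by rw [← h, ← h']

theorem IsAdjointPair.sub {t t' : E →L[ℂ] F} {s s' : F →L[ℂ] E} (h : IsAdjointPair A t s)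
    (h' : IsAdjointPair A t' s') : IsAdjointPair A (t - t') (s - s') := fun x y => by
  simp [h x y, h' x y]

theorem IsAdjointPair.map_smul {t : E →L[ℂ] F} {s : F →L[ℂ] E} (h : IsAdjointPair A t s)
    (a : A) (x : E) : t (a • x) = a • t x := by
  refine ext_inner_left A fun w => ?_
  rw [← h.symm, CStarModule.inner_op_smul_right, CStarModule.inner_op_smul_right, h.symm]

variable [StarOrderedRing A]

theorem continuous_inner_of_continuous {X : Type*} [TopologicalSpace X] {f g : X → E}
    (hf : Continuous f) (hg : Continuous g) : Continuous fun x => inner A (f x) (g x) :=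
  CStarModule.continuous_inner.comp (hf.prodMk hg)

variable (A) in
theorem ext_inner_left_of_denseRange {X : Type*} {p : X → E} (hp : DenseRange p) {x y : E}
    (h : ∀ w, inner A (p w) x = inner A (p w) y) : x = y :=
  ext_inner_left A <| congrFun <| hp.equalizer
    (continuous_inner_of_continuous continuous_id continuous_const)
    (continuous_inner_of_continuous continuous_id continuous_const) (funext h)

theorem norm_le_of_inner_le {x : E} {y : F} (h : inner A x x ≤ inner A y y) : ‖x‖ ≤ ‖y‖ := by
  rw [CStarModule.norm_eq_sqrt_norm_inner_self (A := A) x,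
    CStarModule.norm_eq_sqrt_norm_inner_self (A := A) y]
  exact Real.sqrt_le_sqrt
    (CStarAlgebra.norm_le_norm_of_nonneg_of_le CStarModule.inner_self_nonneg h)

theorem IsAdjointPair.norm_le {t : E →L[ℂ] F} {s : F →L[ℂ] E} (h : IsAdjointPair A t s) :
    ‖s‖ ≤ ‖t‖ := by
  refine s.opNorm_le_bound (norm_nonneg _) fun y => ?_
  rcases eq_or_ne (s y) 0 with hsy | hsy
  · rw [hsy, norm_zero]
    positivity
  · refine le_of_mul_le_mul_right ?_ (norm_pos_iff.mpr hsy)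
    calc ‖s y‖ * ‖s y‖ = ‖inner A (t (s y)) y‖ := by rw [h, ← CStarModule.norm_sq_eq A, sq]
      _ ≤ ‖t (s y)‖ * ‖y‖ := CStarModule.norm_inner_le F
      _ ≤ ‖t‖ * ‖s y‖ * ‖y‖ := by gcongr; exact t.le_opNorm _
      _ = ‖t‖ * ‖y‖ * ‖s y‖ := by ring

theorem IsAdjointPair.norm_eq {t : E →L[ℂ] F} {s : F →L[ℂ] E} (h : IsAdjointPair A t s) :
    ‖s‖ = ‖t‖ :=
  le_antisymm h.norm_le h.symm.norm_le

variable (A E F) in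
theorem isClosed_setOf_isAdjointPair :
    IsClosed {p : (E →L[ℂ] F) × (F →L[ℂ] E) | IsAdjointPair A p.1 p.2} := by
  simp only [IsAdjointPair, Set.ofPred_forall]
  exact isClosed_iInter fun x => isClosed_iInter fun y => isClosed_eq
    (continuous_inner_of_continuous (by fun_prop) continuous_const)
    (continuous_inner_of_continuous continuous_const (by fun_prop))

variable (A E F) in
theorem isClosed_setOf_isAdjointable [CompleteSpace E] [CompleteSpace F] :
    IsClosed {t : E →L[ℂ] F | IsAdjointable A t} := by
  let fst : {p : (E →L[ℂ] F) × (F →L[ℂ] E) | IsAdjointPair A p.1 p.2} → E →L[ℂ] F := fun p => p.1.1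
  have hfst : Isometry fst := Isometry.of_dist_eq fun p p' => by
    have hsnd : dist p.1.2 p'.1.2 = dist p.1.1 p'.1.1 := by
      rw [dist_eq_norm, dist_eq_norm]
      exact (p.2.sub p'.2).norm_eq
    rw [Subtype.dist_eq, Prod.dist_eq, hsnd, max_self]
  have := (isClosed_setOf_isAdjointPair A E F).completeSpace_coe
  have range_fst : Set.range fst = {t | IsAdjointable A t} := by
    ext t
    exact ⟨fun ⟨p, hp⟩ => ⟨p.1.2, hp ▸ p.2⟩, fun ⟨s, hs⟩ => ⟨⟨(t, s), hs⟩, rfl⟩⟩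
  exact range_fst ▸ hfst.isClosedEmbedding.isClosed_range

end Adjointable

section AdjointableAlgebra

variable {A : Type*} [NonUnitalCStarAlgebra A] [PartialOrder A]
  {E : Type*} [NormedAddCommGroup E] [NormedSpace ℂ E] [SMul A E] [CStarModule A E]

variable (A E) in
/-- The adjointable operators, as a subalgebra of the bounded ones. Its elements are the type
`Adj A E`, on which the C⋆-structure is defined. -/
def adjointableSubalgebra : Subalgebra ℂ (E →L[ℂ] E) where
  carrier := {t | IsAdjointable A t}
  mul_mem' := by
    rintro t t' ⟨s, hs⟩ ⟨s', hs'⟩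
    exact ⟨s' * s, fun x y => by simp [hs _ _, hs' _ _]⟩
  add_mem' := by
    rintro t t' ⟨s, hs⟩ ⟨s', hs'⟩
    exact ⟨s + s', fun x y => by simp [hs _ _, hs' _ _]⟩
  algebraMap_mem' c := ⟨algebraMap ℂ _ (star c), fun x y => by
    simp [Algebra.algebraMap_eq_smul_one]⟩

variable (A E) in
/-- The algebra `𝓛(E)` of adjointable operators. As a type of its own, rather than a subtype of the
bounded operators, it carries the spectral order without interfering with other orders. -/
def Adj : Type _ := adjointableSubalgebra A E

namespace Adj

/-- The bounded operator underlying an element of `𝓛(E)`. -/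
def op (t : Adj A E) : E →L[ℂ] E := Subtype.val t

/-- The element of `𝓛(E)` given by an operator with an adjoint. -/
def mk {t s : E →L[ℂ] E} (h : IsAdjointPair A t s) : Adj A E := ⟨t, s, h⟩

instance : NormedRing (Adj A E) := inferInstanceAs (NormedRing (adjointableSubalgebra A E))

instance : NormedAlgebra ℂ (Adj A E) :=
  inferInstanceAs (NormedAlgebra ℂ (adjointableSubalgebra A E))

theorem ext {t s : Adj A E} (h : ∀ x, t.op x = s.op x) : t = s :=
  Subtype.ext (ContinuousLinearMap.ext h)

theorem congr_op {t s : Adj A E} (h : t = s) (x : E) : t.op x = s.op x := by rw [h]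

@[simp] theorem mul_op (t s : Adj A E) (x : E) : (t * s).op x = t.op (s.op x) := rfl
@[simp] theorem add_op (t s : Adj A E) (x : E) : (t + s).op x = t.op x + s.op x := rfl
@[simp] theorem sub_op (t s : Adj A E) (x : E) : (t - s).op x = t.op x - s.op x := rfl
@[simp] theorem neg_op (t : Adj A E) (x : E) : (-t).op x = -t.op x := rfl
@[simp] theorem one_op (x : E) : (1 : Adj A E).op x = x := rfl
@[simp] theorem smul_op (c : ℂ) (t : Adj A E) (x : E) : (c • t).op x = c • t.op x := rfl

variable (A E) in
/-- The inclusion of `𝓛(E)` into the bounded operators, as a continuous linear map. -/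
def opL : Adj A E →L[ℂ] (E →L[ℂ] E) :=
  LinearMap.mkContinuous ⟨⟨op, fun _ _ => rfl⟩, fun _ _ => rfl⟩ 1 fun t => by
    rw [one_mul]
    exact le_rfl

@[simp] theorem opL_apply (t : Adj A E) : opL A E t = t.op := rfl

theorem continuous_op : Continuous (op : Adj A E → E →L[ℂ] E) := (opL A E).continuous

instance : Star (Adj A E) := ⟨fun t => mk t.2.choose_spec.symm⟩

theorem isAdjointPair_star (t : Adj A E) : IsAdjointPair A t.op (star t).op :=
  t.2.choose_spec

theorem inner_left_eq (t : Adj A E) (x y : E) : inner A (t.op x) y = inner A x ((star t).op y) :=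
  isAdjointPair_star t x y

theorem inner_right_eq (t : Adj A E) (x y : E) : inner A x (t.op y) = inner A ((star t).op x) y :=
  ((isAdjointPair_star t).symm x y).symm

theorem op_star_eq {t : Adj A E} {s : E →L[ℂ] E} (h : IsAdjointPair A t.op s) :
    (star t).op = s :=
  (isAdjointPair_star t).unique h

theorem star_eq_of_isAdjointPair {t s : Adj A E} (h : IsAdjointPair A t.op s.op) : star t = s :=
  Subtype.ext (op_star_eq h)

instance : StarRing (Adj A E) where
  star_involutive t := star_eq_of_isAdjointPair (isAdjointPair_star t).symm
  star_mul t s := star_eq_of_isAdjointPair fun x y => by simp [inner_left_eq]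
  star_add t s := star_eq_of_isAdjointPair fun x y => by simp [inner_left_eq]

instance : StarModule ℂ (Adj A E) where
  star_smul c t := star_eq_of_isAdjointPair fun x y => by simp [inner_left_eq]

theorem inner_star_mul_self_op (t : Adj A E) (x y : E) :
    inner A x ((star t * t).op y) = inner A (t.op x) (t.op y) := by
  rw [inner_left_eq, mul_op]

variable [StarOrderedRing A]

instance : CStarRing (Adj A E) where
  norm_mul_self_le t := by
    have norm_le_sqrt : ‖t‖ ≤ √‖star t * t‖ := by
      refine t.op.opNorm_le_bound (Real.sqrt_nonneg _) fun x => ?_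
      refine (pow_le_pow_iff_left₀ (norm_nonneg _) (by positivity) two_ne_zero).mp ?_
      calc ‖t.op x‖ ^ 2 = ‖inner A x ((star t * t).op x)‖ := by
            rw [CStarModule.norm_sq_eq A, inner_left_eq, mul_op]
        _ ≤ ‖x‖ * ‖(star t * t).op x‖ := CStarModule.norm_inner_le E
        _ ≤ ‖x‖ * (‖star t * t‖ * ‖x‖) := by
          gcongr
          exact ContinuousLinearMap.le_opNorm _ _
        _ = (√‖star t * t‖ * ‖x‖) ^ 2 := by
          rw [mul_pow, Real.sq_sqrt (norm_nonneg _)]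
          ring
    calc ‖t‖ * ‖t‖ ≤ √‖star t * t‖ * √‖star t * t‖ := by gcongr
      _ = ‖star t * t‖ := Real.mul_self_sqrt (norm_nonneg _)

variable [CompleteSpace E]

instance : CompleteSpace (Adj A E) := (isClosed_setOf_isAdjointable A E E).completeSpace_coe

instance : CStarAlgebra (Adj A E) where

instance : PartialOrder (Adj A E) := CStarAlgebra.spectralOrder _

instance : StarOrderedRing (Adj A E) := CStarAlgebra.spectralOrderedRing _

theorem inner_op_nonneg {t : Adj A E} (ht : 0 ≤ t) (v : E) : 0 ≤ inner A v (t.op v) := by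
  obtain ⟨s, rfl⟩ := CStarAlgebra.nonneg_iff_eq_star_mul_self.mp ht
  rw [inner_star_mul_self_op]
  exact CStarModule.inner_self_nonneg

theorem eq_zero_of_inner_op_eq_zero {t : Adj A E} (ht : 0 ≤ t)
    (h : ∀ v, inner A v (t.op v) = 0) : t = 0 := by
  obtain ⟨s, rfl⟩ := CStarAlgebra.nonneg_iff_eq_star_mul_self.mp ht
  have hs : s = 0 := ext fun v =>
    CStarModule.inner_self.mp ((inner_star_mul_self_op s v v).symm.trans (h v))
  simp [hs]

theorem nonneg_of_inner_op_nonneg {t : Adj A E} (ht : IsSelfAdjoint t)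
    (h : ∀ v, 0 ≤ inner A v (t.op v)) : 0 ≤ t := by
  obtain ⟨n, hn, mul_n, n_eq⟩ : ∃ n : Adj A E, 0 ≤ n ∧ t * n = -(n * n) ∧ (n = 0 → 0 ≤ t) := by
    refine ⟨t⁻, CFC.negPart_nonneg t, ?_, (CFC.negPart_eq_zero_iff t ht).mp⟩
    nth_rw 1 [← CFC.posPart_sub_negPart t ht]
    rw [sub_mul, CFC.posPart_mul_negPart, zero_sub]
  have hn_star : star n = n := (IsSelfAdjoint.of_nonneg hn).star_eq
  have cube_nonneg : 0 ≤ n * n * n := conjugate_nonneg_of_nonneg hn hn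
  -- Testing positivity of `t` on the range of its negative part gives `⟨v, n³ v⟩ ≤ 0`.
  have inner_cube (v : E) : inner A v ((n * n * n).op v) = -inner A (n.op v) (t.op (n.op v)) := by
    rw [← mul_op t, mul_n, inner_left_eq, hn_star]
    simp
  have cube_eq_zero : n * n * n = 0 := eq_zero_of_inner_op_eq_zero cube_nonneg fun v =>
    le_antisymm (by rw [inner_cube]; exact neg_nonpos.mpr (h _)) (inner_op_nonneg cube_nonneg v)
  have sq_eq_zero : n * n = 0 := by
    rw [← CStarRing.star_mul_self_eq_zero_iff, star_mul, hn_star, ← mul_assoc, cube_eq_zero,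
      zero_mul]
  refine n_eq ?_
  rwa [← CStarRing.star_mul_self_eq_zero_iff, hn_star]

theorem isPositive_op_iff {t : Adj A E} : IsPositive A t.op ↔ 0 ≤ t :=
  ⟨fun h => nonneg_of_inner_op_nonneg (star_eq_of_isAdjointPair h.1) h.2,
    fun h => ⟨fun x y => by rw [inner_left_eq, (IsSelfAdjoint.of_nonneg h).star_eq],
      inner_op_nonneg h⟩⟩

end Adj

end AdjointableAlgebra

section Calculus

theorem rel_cfc {B C : Type*} [CStarAlgebra B] [CStarAlgebra C] {P : B → C → Prop}
    (algebraMap : ∀ c : ℂ, P (algebraMap ℂ B c) (algebraMap ℂ C c))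
    (add : ∀ x x' y y', P x y → P x' y' → P (x + x') (y + y'))
    (mul : ∀ x x' y y', P x y → P x' y' → P (x * x') (y * y'))
    (isClosed : IsClosed {p : B × C | P p.1 p.2}) {a : B} {b : C}
    (ha : IsStarNormal a) (hb : IsStarNormal b) {φ : ℂ → ℂ}
    (hφ : ContinuousOn φ (spectrum ℂ a ∪ spectrum ℂ b)) (hab : P a b)
    (hab_star : P (star a) (star b)) : P (cfc φ a) (cfc φ b) := by
  let W : StarSubalgebra ℂ (B × C) :=
    { carrier := {p | P p.1 p.2 ∧ P (star p.1) (star p.2)}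
      mul_mem' := by
        rintro p q ⟨hp, hp_star⟩ ⟨hq, hq_star⟩
        exact ⟨mul _ _ _ _ hp hq, by simpa using mul _ _ _ _ hq_star hp_star⟩
      add_mem' := by
        rintro p q ⟨hp, hp_star⟩ ⟨hq, hq_star⟩
        exact ⟨add _ _ _ _ hp hq, by simpa using add _ _ _ _ hp_star hq_star⟩
      algebraMap_mem' c := ⟨algebraMap c, by
        simpa [Algebra.algebraMap_eq_smul_one] using algebraMap (star c)⟩
      star_mem' := by
        rintro p ⟨hp, hp_star⟩
        exact ⟨hp_star, by simpa using hp⟩ }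
  have : IsClosed (W : Set (B × C)) :=
    isClosed.inter (isClosed.preimage (continuous_star (R := B × C)))
  have mem_W := cfc_mem (𝕜 := ℂ) (𝕜' := ℂ) (s := W) φ (a := (a, b)) ⟨hab, hab_star⟩
  rw [cfc_map_prod (S := ℂ) φ a b hφ ⟨Prod.ext ha.1 hb.1⟩ ha hb] at mem_W
  exact mem_W.1

theorem cfc_mem_closure_range_cfc_mul {B : Type*} [CStarAlgebra B] {a : B} (ha : IsStarNormal a)
    {φ ψ : ℂ → ℂ} (hφ : ContinuousOn φ (spectrum ℂ a)) (hψ : ContinuousOn ψ (spectrum ℂ a))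
    (h : ∀ x ∈ spectrum ℂ a, φ x = 0 → ψ x = 0) :
    cfc ψ a ∈ closure (Set.range fun b => cfc φ a * b) := by
  have : CompactSpace (spectrum ℂ a) := isCompact_iff_compactSpace.mp (spectrum.isCompact a)
  let φ' : C(spectrum ℂ a, ℂ) := ⟨_, hφ.domRestrict⟩
  let ψ' : C(spectrum ℂ a, ℂ) := ⟨_, hψ.domRestrict⟩
  have mem_closure : ψ' ∈ (Ideal.span {φ'}).closure := by
    rw [← ContinuousMap.idealOfSet_ofIdeal_eq_closure, ContinuousMap.mem_idealOfSet]
    refine fun x hx => h x x.2 ?_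
    exact ContinuousMap.notMem_setOfIdeal.mp hx (Ideal.mem_span_singleton_self φ')
  rw [cfc_apply φ a, cfc_apply ψ a]
  refine map_mem_closure (cfcHom_continuous ha) mem_closure fun χ hχ => ?_
  obtain ⟨χ', rfl⟩ := Ideal.mem_span_singleton.mp hχ
  exact ⟨cfcHom ha χ', (map_mul (cfcHom ha) φ' χ').symm⟩

variable {A : Type*} [NonUnitalCStarAlgebra A] [PartialOrder A] [StarOrderedRing A]
  {E F : Type*}
  [NormedAddCommGroup E] [NormedSpace ℂ E] [SMul A E] [CStarModule A E] [CompleteSpace E]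
  [NormedAddCommGroup F] [NormedSpace ℂ F] [SMul A F] [CStarModule A F] [CompleteSpace F]

theorem denseRange_cfc {a : Adj A E} (ha : IsStarNormal a) {φ ψ : ℂ → ℂ}
    (hφ : ContinuousOn φ (spectrum ℂ a)) (hψ : ContinuousOn ψ (spectrum ℂ a))
    (h : ∀ x ∈ spectrum ℂ a, φ x = 0 → ψ x = 0) (hd : DenseRange (cfc ψ a).op) :
    DenseRange (cfc φ a).op := by
  refine Dense.of_closure (hd.mono ?_)
  rintro _ ⟨v, rfl⟩
  refine map_mem_closure (f := fun t : Adj A E => t.op v) ?_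
    (cfc_mem_closure_range_cfc_mul ha hφ hψ h) ?_
  · exact Adj.continuous_op.clm_apply continuous_const
  · rintro _ ⟨b, rfl⟩
    exact ⟨b.op v, rfl⟩

theorem norm_op_le_of_star_mul_self_le {s t : Adj A E} (h : star s * s ≤ star t * t) (v : E) :
    ‖s.op v‖ ≤ ‖t.op v‖ := by
  refine norm_le_of_inner_le (A := A) ?_
  rw [← Adj.inner_star_mul_self_op, ← Adj.inner_star_mul_self_op, ← sub_nonneg,
    ← CStarModule.inner_sub_right]
  exact Adj.inner_op_nonneg (sub_nonneg.mpr h) v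

theorem norm_cfc_op_le {a : Adj A E} {φ ψ : ℂ → ℂ}
    (hφ : ContinuousOn φ (spectrum ℂ a)) (hψ : ContinuousOn ψ (spectrum ℂ a))
    (h : ∀ x ∈ spectrum ℂ a, ‖φ x‖ ≤ ‖ψ x‖) (v : E) : ‖(cfc φ a).op v‖ ≤ ‖(cfc ψ a).op v‖ := by
  refine norm_op_le_of_star_mul_self_le ?_ v
  rw [← cfc_star, ← cfc_star, ← cfc_mul _ _ a hφ.star hφ, ← cfc_mul _ _ a hψ.star hψ]
  refine cfc_mono (fun x hx => ?_) (hφ.star.mul hφ) (hψ.star.mul hψ)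
  simp only [Complex.star_def, Complex.conj_mul']
  exact_mod_cast pow_le_pow_left₀ (norm_nonneg _) (h x hx) 2

end Calculus

section Intertwines

variable {A : Type*} [NonUnitalCStarAlgebra A] [PartialOrder A] {E F : Type*}
  [NormedAddCommGroup E] [NormedSpace ℂ E] [SMul A E] [CStarModule A E]
  [NormedAddCommGroup F] [NormedSpace ℂ F] [SMul A F] [CStarModule A F]

theorem eq_of_mul_eq_of_denseRange {a b d : Adj A E} (hd : DenseRange d.op)
    (h : a * d = b * d) : a = b :=
  Adj.ext <| congrFun <| hd.equalizer a.op.continuous b.op.continuous <| funext <| Adj.congr_op h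

theorem denseRange_mul {a b : Adj A E} (ha : DenseRange a.op) (hb : DenseRange b.op) :
    DenseRange (a * b).op :=
  DenseRange.comp (g := a.op) (f := b.op) ha hb a.op.continuous

variable [StarOrderedRing A] in
theorem eq_zero_of_denseRange_star {a : Adj A E} (ha : DenseRange (star a).op) {v : E}
    (hv : a.op v = 0) : v = 0 :=
  ext_inner_left_of_denseRange A ha fun w => by
    rw [← Adj.inner_right_eq, hv, CStarModule.inner_zero_right, CStarModule.inner_zero_right]

/-- The relation `U a = b U`, for `a ∈ 𝓛(E)` and `b ∈ 𝓛(F)`. -/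
def Intertwines (U : E →L[ℂ] F) (a : Adj A E) (b : Adj A F) : Prop :=
  ∀ x, U (a.op x) = b.op (U x)

theorem isClosed_setOf_intertwines (U : E →L[ℂ] F) :
    IsClosed {p : Adj A E × Adj A F | Intertwines U p.1 p.2} := by
  simp only [Intertwines, Set.ofPred_forall]
  refine isClosed_iInter fun x => isClosed_eq ?_ ?_
  · exact U.continuous.comp ((Adj.continuous_op.comp continuous_fst).clm_apply continuous_const)
  · exact (Adj.continuous_op.comp continuous_snd).clm_apply continuous_const

variable [StarOrderedRing A] [CompleteSpace E] [CompleteSpace F]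

theorem Intertwines.cfc {U : E →L[ℂ] F} {a : Adj A E} {b : Adj A F}
    (ha : IsStarNormal a) (hb : IsStarNormal b) (h : Intertwines U a b)
    (h_star : Intertwines U (star a) (star b)) {φ : ℂ → ℂ}
    (hφ : ContinuousOn φ (spectrum ℂ a ∪ spectrum ℂ b)) :
    Intertwines U (cfc φ a) (cfc φ b) := by
  refine rel_cfc (P := Intertwines U) (fun c x => ?_) (fun p p' r r' h h' x => ?_)
    (fun p p' r r' h h' x => ?_) (isClosed_setOf_intertwines (A := A) U) ha hb hφ h h_star
  · simp [Algebra.algebraMap_eq_smul_one]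
  · simp [h x, h' x]
  · simp [h _, h' x]

theorem sqrt_eq_cfc {a : Adj A E} (ha : 0 ≤ a) :
    CFC.sqrt a = _root_.cfc (fun x : ℂ => ((√x.re : ℝ) : ℂ)) a := by
  rw [CFC.sqrt_eq_real_sqrt a ha, cfcₙ_eq_cfc, cfc_real_eq_complex]

theorem Intertwines.sqrt {U : E →L[ℂ] F} {a : Adj A E} {b : Adj A F}
    (ha : 0 ≤ a) (hb : 0 ≤ b) (h : Intertwines U a b) :
    Intertwines U (CFC.sqrt a) (CFC.sqrt b) := by
  have ha' := IsSelfAdjoint.of_nonneg ha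
  have hb' := IsSelfAdjoint.of_nonneg hb
  rw [sqrt_eq_cfc ha, sqrt_eq_cfc hb]
  exact Intertwines.cfc ha'.isStarNormal hb'.isStarNormal h
    (by rwa [ha'.star_eq, hb'.star_eq]) (by fun_prop)

theorem Intertwines.of_mul_self {U : E →L[ℂ] F} {a : Adj A E} {b : Adj A F}
    (ha : 0 ≤ a) (hb : 0 ≤ b) (h : Intertwines U (a * a) (b * b)) : Intertwines U a b := by
  have := h.sqrt (by simpa [(IsSelfAdjoint.of_nonneg ha).star_eq] using star_mul_self_nonneg a)
    (by simpa [(IsSelfAdjoint.of_nonneg hb).star_eq] using star_mul_self_nonneg b)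
  rwa [CFC.sqrt_mul_self a ha, CFC.sqrt_mul_self b hb] at this

end Intertwines

section Multipliers

variable {A : Type*} [NonUnitalCStarAlgebra A] [PartialOrder A] [StarOrderedRing A]
  {E F : Type*}
  [NormedAddCommGroup E] [NormedSpace ℂ E] [SMul A E] [CStarModule A E] [CompleteSpace E]
  [NormedAddCommGroup F] [NormedSpace ℂ F] [SMul A F] [CStarModule A F] [CompleteSpace F]

theorem exists_adjointable_extension {X Y : Type*} [AddCommGroup X] [Module ℂ X]
    [AddCommGroup Y] [Module ℂ Y] {p m : X →ₗ[ℂ] E} {p' m' : Y →ₗ[ℂ] E} (hp : DenseRange p)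
    (hp' : DenseRange p') (hm : ∀ x, ‖m x‖ ≤ ‖p x‖) (hm' : ∀ y, ‖m' y‖ ≤ ‖p' y‖)
    (h : ∀ x y, inner A (m x) (p' y) = inner A (p x) (m' y)) :
    ∃ t : Adj A E, ‖t‖ ≤ 1 ∧ (∀ x, t.op (p x) = m x) ∧
      ∀ y, (star t).op (p' y) = m' y := by
  replace hm : ∀ x, ‖m x‖ ≤ 1 * ‖p x‖ := by simpa using hm
  replace hm' : ∀ y, ‖m' y‖ ≤ 1 * ‖p' y‖ := by simpa using hm'
  have extend_p := LinearMap.extendOfNorm_eq (f := m) hp ⟨1, hm⟩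
  have extend_p' := LinearMap.extendOfNorm_eq (f := m') hp' ⟨1, hm'⟩
  have hadj : IsAdjointPair A (m.extendOfNorm p) (m'.extendOfNorm p') := by
    refine fun x y => (hp.prodMap hp').induction_on (x, y)
      (p := fun z => inner A (m.extendOfNorm p z.1) z.2 = inner A z.1 (m'.extendOfNorm p' z.2))
      (isClosed_eq (continuous_inner_of_continuous (by fun_prop) (by fun_prop))
        (continuous_inner_of_continuous (by fun_prop) (by fun_prop))) fun z => ?_
    rw [Prod.map_fst, Prod.map_snd, extend_p, extend_p', h]
  refine ⟨Adj.mk hadj, LinearMap.opNorm_extendOfNorm_le hp zero_le_one hm, extend_p, fun y => ?_⟩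
  rw [Adj.op_star_eq (t := Adj.mk hadj) hadj, extend_p']

theorem continuousOn_mul_of_continuousOn_ne_zero {X : Type*} [TopologicalSpace X] {s : Set X}
    {φ h : X → ℂ} {C : ℝ} (hh : ContinuousOn h s) (hC : ∀ x ∈ s, ‖φ x‖ ≤ C)
    (hφ : ContinuousOn φ (s ∩ {x | h x ≠ 0})) : ContinuousOn (fun x => φ x * h x) s := by
  intro x hx
  by_cases h0 : h x = 0
  · have tendsto_h : Filter.Tendsto h (nhdsWithin x s) (nhds 0) := h0 ▸ hh x hx
    rw [ContinuousWithinAt, h0, mul_zero]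
    refine squeeze_zero_norm' ?_ (by simpa using tendsto_h.norm.const_mul C)
    filter_upwards [self_mem_nhdsWithin] with y hy
    rw [norm_mul]
    exact mul_le_mul_of_nonneg_right (hC y hy) (norm_nonneg _)
  · have ne_zero_near : {y | h y ≠ 0} ∈ nhdsWithin x s := (hh x hx).eventually_ne h0
    exact ((hφ x ⟨hx, h0⟩).mono_of_mem_nhdsWithin
      (Filter.inter_mem self_mem_nhdsWithin ne_zero_near)).mul (hh x hx)

/-- If `h(a)` has dense range, the dense definition `h(a) v ↦ (φ h)(a) v` of `φ(a)` makes sense for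
bounded `φ` that are discontinuous only at zeros of `h`. -/
theorem exists_mul_cfc_eq_cfc_mul {a : Adj A E} {φ h : ℂ → ℂ}
    (norm_φ_le : ∀ x ∈ spectrum ℂ a, ‖φ x‖ ≤ 1) (hh : ContinuousOn h (spectrum ℂ a))
    (hφ : ContinuousOn φ (spectrum ℂ a ∩ {x | h x ≠ 0})) (hd : DenseRange (cfc h a).op) :
    ∃ t : Adj A E, ‖t‖ ≤ 1 ∧ t * cfc h a = cfc (fun x => φ x * h x) a ∧
      star t * cfc h a = cfc (fun x => star (φ x) * h x) a := by
  have norm_star_φ_le : ∀ x ∈ spectrum ℂ a, ‖star (φ x)‖ ≤ 1 := by simpa using norm_φ_le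
  have norm_mul_le {χ : ℂ → ℂ} (hχ : ∀ x ∈ spectrum ℂ a, ‖χ x‖ ≤ 1) :
      ∀ x ∈ spectrum ℂ a, ‖χ x * h x‖ ≤ ‖h x‖ := fun x hx => by
    rw [norm_mul]
    exact mul_le_of_le_one_left (norm_nonneg _) (hχ x hx)
  have hφh := continuousOn_mul_of_continuousOn_ne_zero hh norm_φ_le hφ
  have hφh_star := continuousOn_mul_of_continuousOn_ne_zero hh norm_star_φ_le hφ.star
  have star_mul_eq : star (cfc (fun x => φ x * h x) a) * cfc h a =
      star (cfc h a) * cfc (fun x => star (φ x) * h x) a := by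
    rw [← cfc_star, ← cfc_star, ← cfc_mul _ _ a hφh.star hh, ← cfc_mul _ _ a hh.star hφh_star]
    congr! 2 with x
    rw [star_mul, mul_assoc]
  obtain ⟨t, norm_t, ht, ht_star⟩ := exists_adjointable_extension (A := A)
    (p := (cfc h a).op.toLinearMap) (m := (cfc (fun x => φ x * h x) a).op.toLinearMap)
    (p' := (cfc h a).op.toLinearMap) (m' := (cfc (fun x => star (φ x) * h x) a).op.toLinearMap)
    hd hd (norm_cfc_op_le hφh hh (norm_mul_le norm_φ_le))
    (norm_cfc_op_le hφh_star hh (norm_mul_le norm_star_φ_le))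
    fun x y => by
      simpa [Adj.inner_left_eq] using congrArg (inner A x) (Adj.congr_op star_mul_eq y)
  exact ⟨t, norm_t, Adj.ext ht, Adj.ext ht_star⟩

end Multipliers

section BoundedFuglede

variable {A : Type*} [NonUnitalCStarAlgebra A] [PartialOrder A] {E F : Type*}
  [NormedAddCommGroup E] [NormedSpace ℂ E] [SMul A E] [CStarModule A E]
  [NormedAddCommGroup F] [NormedSpace ℂ F] [SMul A F] [CStarModule A F]

theorem Intertwines.smul {U : E →L[ℂ] F} {a : Adj A E} {b : Adj A F} (h : Intertwines U a b)
    (c : ℂ) : Intertwines U (c • a) (c • b) := fun x => by simp [h x]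

theorem Intertwines.pow {U : E →L[ℂ] F} {a : Adj A E} {b : Adj A F} (h : Intertwines U a b)
    (n : ℕ) : Intertwines U (a ^ n) (b ^ n) := by
  induction n with
  | zero => intro x; simp
  | succ n ih => intro x; rw [pow_succ, pow_succ, Adj.mul_op, Adj.mul_op, ih, h]

variable [StarOrderedRing A] [CompleteSpace E]

theorem Adj.norm_exp_le_one {t : Adj A E} (ht : t ∈ skewAdjoint (Adj A E)) : ‖exp t‖ ≤ 1 := by
  let _ : NormedAlgebra ℚ (Adj A E) := .restrictScalars ℚ ℂ _
  rw [← mul_one (exp t), CStarRing.norm_mem_unitary_mul _ (exp_mem_unitary_of_mem_skewAdjoint ht)]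
  exact ContinuousLinearMap.norm_id_le

theorem hasDerivAt_exp_smul_op (t : Adj A E) (x : E) :
    HasDerivAt (fun c : ℂ => (exp (c • t)).op x) (t.op x) 0 := by
  have hasDerivAt_exp : HasDerivAt (fun c : ℂ => exp (c • t)) t 0 := by
    simpa using hasDerivAt_exp_smul_const t (0 : ℂ)
  exact ((ContinuousLinearMap.apply ℂ E x).comp (Adj.opL A E)).hasFDerivAt.comp_hasDerivAt 0
    hasDerivAt_exp

theorem differentiable_opL_exp_smul (t : Adj A E) :
    Differentiable ℂ fun c : ℂ => Adj.opL A E (exp (c • t)) :=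
  (Adj.opL A E).differentiable.comp fun c => (hasDerivAt_exp_smul_const t c).differentiableAt

theorem exp_neg_op_exp_op (t : Adj A E) (x : E) : (exp (-t)).op ((exp t).op x) = x := by
  let _ : NormedAlgebra ℚ (Adj A E) := .restrictScalars ℚ ℂ _
  rw [← Adj.mul_op, ← exp_add_of_commute (Commute.refl t).neg_left, neg_add_cancel, exp_zero,
    Adj.one_op]

theorem exp_add_op {s t : Adj A E} (h : Commute s t) (x : E) :
    (exp (s + t)).op x = (exp s).op ((exp t).op x) := by
  let _ : NormedAlgebra ℚ (Adj A E) := .restrictScalars ℚ ℂ _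
  rw [exp_add_of_commute h, Adj.mul_op]

variable [CompleteSpace F]

theorem Intertwines.exp {U : E →L[ℂ] F} {a : Adj A E} {b : Adj A F} (h : Intertwines U a b) :
    Intertwines U (exp a) (exp b) := by
  intro x
  have hasSum_U_exp := (((exp_series_hasSum_exp' (𝕂 := ℂ) a).mapL (Adj.opL A E)).mapL
    (ContinuousLinearMap.apply ℂ E x)).mapL U
  have hasSum_exp := ((exp_series_hasSum_exp' (𝕂 := ℂ) b).mapL (Adj.opL A F)).mapL
    (ContinuousLinearMap.apply ℂ F (U x))
  refine hasSum_U_exp.unique ?_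
  convert! hasSum_exp using 2 with n
  simp [h.pow n x]

theorem Intertwines.of_exp_smul {U : E →L[ℂ] F} {a : Adj A E} {b : Adj A F}
    (h : ∀ c : ℂ, Intertwines U (NormedSpace.exp (c • a)) (NormedSpace.exp (c • b))) :
    Intertwines U a b := fun x => by
  refine (U.hasFDerivAt.comp_hasDerivAt 0 (hasDerivAt_exp_smul_op a x)).unique ?_
  convert! hasDerivAt_exp_smul_op b (U x) using 1
  exact funext fun c => h c x

/-- The entire function `c ↦ exp(c b) U exp(-c a)`, to which Liouville's theorem is applied in
Rosenblum's proof of the Fuglede–Putnam theorem. -/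
def expConj (U : E →L[ℂ] F) (a : Adj A E) (b : Adj A F) (c : ℂ) : E →L[ℂ] F :=
  (Adj.opL A F (exp (c • b))).comp (U.comp (Adj.opL A E (exp (c • -a))))

theorem differentiable_expConj (U : E →L[ℂ] F) (a : Adj A E) (b : Adj A F) :
    Differentiable ℂ (expConj U a b) :=
  (differentiable_opL_exp_smul b).clm_comp
    ((differentiable_const U).clm_comp (differentiable_opL_exp_smul (-a)))

/-- As `U` intertwines `exp(c̄ a)` with `exp(c̄ b)`, it is also surrounded by exponentials of the
skew-adjoint elements `c b⋆ - c̄ b` and `c̄ a - c a⋆`. -/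
theorem Intertwines.norm_expConj_star_le {U : E →L[ℂ] F} {a : Adj A E} {b : Adj A F}
    (ha : IsStarNormal a) (hb : IsStarNormal b) (h : Intertwines U a b) (c : ℂ) :
    ‖expConj U (star a) (star b) c‖ ≤ ‖U‖ := by
  set s := c • star b + -(star c • b) with hs
  set t := star c • a + c • -star a with ht
  have expConj_eq : expConj U (star a) (star b) c =
      (NormedSpace.exp s).op.comp (U.comp (NormedSpace.exp t).op) := by
    have hcb : Commute (c • star b) (-(star c • b)) :=
      ((hb.star_comm_self.smul_left c).smul_right _).neg_right
    have hca : Commute (star c • a) (c • -star a) :=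
      (ha.star_comm_self.symm.neg_right.smul_left _).smul_right c
    ext x
    simp only [expConj, Adj.opL_apply, ContinuousLinearMap.comp_apply]
    rw [exp_add_op hcb, exp_add_op hca, (h.smul _).exp, exp_neg_op_exp_op]
  have norm_exp_s : ‖NormedSpace.exp s‖ ≤ 1 :=
    Adj.norm_exp_le_one (skewAdjoint.mem_iff.mpr (by simp [hs]))
  have norm_exp_t : ‖NormedSpace.exp t‖ ≤ 1 :=
    Adj.norm_exp_le_one (skewAdjoint.mem_iff.mpr (by simp [ht]))
  calc ‖expConj U (star a) (star b) c‖
      ≤ ‖(NormedSpace.exp s).op‖ * (‖U‖ * ‖(NormedSpace.exp t).op‖) := by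
        rw [expConj_eq]
        refine (ContinuousLinearMap.opNorm_comp_le _ _).trans ?_
        gcongr
        exact ContinuousLinearMap.opNorm_comp_le _ _
    _ ≤ 1 * (‖U‖ * 1) := by gcongr <;> assumption
    _ = ‖U‖ := by ring

theorem Intertwines.star {U : E →L[ℂ] F} {a : Adj A E} {b : Adj A F} (ha : IsStarNormal a)
    (hb : IsStarNormal b) (h : Intertwines U a b) : Intertwines U (star a) (star b) := by
  refine .of_exp_smul fun c x => ?_
  have bounded : Bornology.IsBounded (Set.range (expConj U (Star.star a) (Star.star b))) :=
    isBounded_iff_forall_norm_le.mpr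
      ⟨‖U‖, Set.forall_mem_range.mpr (h.norm_expConj_star_le ha hb)⟩
  have expConj_eq : expConj U (Star.star a) (Star.star b) c = U := by
    rw [(differentiable_expConj U _ _).apply_eq_apply_of_bounded bounded c 0]
    ext x
    simp [expConj]
  nth_rw 1 [← expConj_eq]
  simp only [expConj, Adj.opL_apply, ContinuousLinearMap.comp_apply, smul_neg, exp_neg_op_exp_op]

end BoundedFuglede

section Adjoint

theorem isModuleMap_of_smul_mem_graph {A E F : Type*} [NormedAddCommGroup E] [NormedSpace ℂ E]
    [NormedAddCommGroup F] [NormedSpace ℂ F] [SMul A E] [SMul A F] {T : E →ₗ.[ℂ] F}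
    (h : ∀ (a : A) x y, (x, y) ∈ T.graph → (a • x, a • y) ∈ T.graph) : IsModuleMap A T := by
  intro a x
  obtain ⟨⟨_, hu⟩, rfl, T_u⟩ :=
    (LinearPMap.mem_graph_iff T).mp (h a _ _ (LinearPMap.mem_graph T x))
  exact ⟨hu, T_u⟩

variable {A : Type*} [NonUnitalCStarAlgebra A] [PartialOrder A] {E F : Type*}
  [NormedAddCommGroup E] [NormedSpace ℂ E] [SMul A E] [CStarModule A E]
  [NormedAddCommGroup F] [NormedSpace ℂ F] [SMul A F] [CStarModule A F]

theorem mem_adjointGraph_iff {T : E →ₗ.[ℂ] F} {v : F} {w : E} :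
    (v, w) ∈ adjointGraph A T ↔ ∀ x y, (x, y) ∈ T.graph → inner A y v = inner A x w := by
  constructor
  · intro h x y hxy
    obtain ⟨u, rfl, rfl⟩ := (LinearPMap.mem_graph_iff T).mp hxy
    exact h u
  · exact fun h u => h _ _ (LinearPMap.mem_graph T u)

variable (A) in
/-- `R = (1 + T⋆T)⁻¹` and `N = T(1 + T⋆T)⁻¹`. -/
structure IsResolventPair (T : E →ₗ.[ℂ] F) (R : E →L[ℂ] E) (N : E →L[ℂ] F) : Prop where
  mem_graph : ∀ e, (R e, N e) ∈ T.graph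
  mem_adjointGraph : ∀ e, (N e, e - R e) ∈ adjointGraph A T

theorem IsResolventPair.inner_left_eq {T : E →ₗ.[ℂ] F} {R : E →L[ℂ] E} {N : E →L[ℂ] F}
    (h : IsResolventPair A T R N) (e e' : E) :
    inner A (R e) e' = inner A (R e) (R e') + inner A (N e) (N e') := by
  rw [mem_adjointGraph_iff.mp (h.mem_adjointGraph e') _ _ (h.mem_graph e),
    ← CStarModule.inner_add_right, add_sub_cancel]

variable [StarOrderedRing A]

theorem adjoint_graph {T : E →ₗ.[ℂ] F} (hd : Dense (T.domain : Set E)) :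
    (adjoint A T).graph = adjointGraph A T := by
  refine Submodule.toLinearPMap_graph_eq _ fun p hp hp_fst => ?_
  refine ext_inner_left_of_denseRange A hd.denseRange_val fun u => ?_
  rw [← hp u, hp_fst, CStarModule.inner_zero_right, CStarModule.inner_zero_right]

theorem isClosed_adjointGraph (T : E →ₗ.[ℂ] F) : IsClosed (adjointGraph A T : Set (F × E)) := by
  have : (adjointGraph A T : Set (F × E)) =
      ⋂ u : T.domain, {p | inner A (T u) p.1 = inner A (u : E) p.2} := by
    ext p
    simp only [Set.mem_iInter]
    rfl
  rw [this]
  exact isClosed_iInter fun u => isClosed_eq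
    (continuous_inner_of_continuous continuous_const continuous_fst)
    (continuous_inner_of_continuous continuous_const continuous_snd)

theorem mem_range_one_add_adjoint_comp_iff {T : E →ₗ.[ℂ] F} (hd : Dense (T.domain : Set E))
    {e : E} : e ∈ Set.range (toP (ContinuousLinearMap.id ℂ E) + pcomp (adjoint A T) T).toFun ↔
      ∃ x y, (x, y) ∈ T.graph ∧ (y, e - x) ∈ adjointGraph A T := by
  simp only [← adjoint_graph hd]
  constructor
  · rintro ⟨⟨x, hx⟩, rfl⟩
    obtain ⟨y, hxy, hy⟩ := (mem_graph_pcomp _ _ _ _).mp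
      (LinearPMap.mem_graph (pcomp (adjoint A T) T) ⟨x, (Submodule.mem_inf.mp hx).2⟩)
    refine ⟨x, y, hxy, ?_⟩
    rw [LinearPMap.toFun_eq_coe, LinearPMap.add_apply]
    convert! hy using 2
    exact add_sub_cancel_left _ _
  · rintro ⟨x, y, hxy, hy⟩
    obtain ⟨u, rfl, hu⟩ := (LinearPMap.mem_graph_iff _).mp
      ((mem_graph_pcomp (adjoint A T) T x _).mpr ⟨y, hxy, hy⟩)
    refine ⟨⟨u, Submodule.mem_inf.mpr ⟨trivial, u.2⟩⟩, ?_⟩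
    rw [LinearPMap.toFun_eq_coe, LinearPMap.add_apply]
    exact (congrArg ((u : E) + ·) hu).trans (add_sub_cancel _ _)

end Adjoint

section Resolvent

variable {A : Type*} [NonUnitalCStarAlgebra A] [PartialOrder A] [StarOrderedRing A]
  {E F G : Type*}
  [NormedAddCommGroup E] [NormedSpace ℂ E] [SMul A E] [CStarModule A E]
  [NormedAddCommGroup F] [NormedSpace ℂ F] [SMul A F] [CStarModule A F]
  [NormedAddCommGroup G] [NormedSpace ℂ G] [SMul A G] [CStarModule A G]

theorem norm_prodMk_le_of_inner_add_eq {x : E} {y : F} {z e : G} (hz : ‖z‖ ≤ ‖(x, y)‖)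
    (h : inner A x x + inner A y y = inner A z e) : ‖(x, y)‖ ≤ ‖e‖ := by
  have norm_sq_le : ‖(x, y)‖ ^ 2 ≤ ‖z‖ * ‖e‖ := by
    refine le_trans ?_ (h ▸ CStarModule.norm_inner_le G)
    rcases max_choice ‖x‖ ‖y‖ with hmax | hmax <;>
      rw [Prod.norm_mk, hmax, CStarModule.norm_sq_eq A] <;>
      refine CStarAlgebra.norm_le_norm_of_nonneg_of_le CStarModule.inner_self_nonneg ?_
    · exact le_add_of_nonneg_right CStarModule.inner_self_nonneg
    · exact le_add_of_nonneg_left CStarModule.inner_self_nonneg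
  by_contra! hlt
  nlinarith [norm_nonneg e]

theorem norm_le_of_mem_graph_of_mem_adjointGraph {T : E →ₗ.[ℂ] F} {e x : E} {y : F}
    (hxy : (x, y) ∈ T.graph) (hy : (y, e - x) ∈ adjointGraph A T) : ‖(x, y)‖ ≤ ‖e‖ := by
  refine norm_prodMk_le_of_inner_add_eq (A := A) (norm_fst_le (x, y)) ?_
  rw [mem_adjointGraph_iff.mp hy x y hxy, ← CStarModule.inner_add_right, add_sub_cancel]

theorem IsResolventPair.eq_of_mem {T : E →ₗ.[ℂ] F} {R : E →L[ℂ] E} {N : E →L[ℂ] F}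
    (h : IsResolventPair A T R N) {e x : E} {y : F} (hxy : (x, y) ∈ T.graph)
    (hy : (y, e - x) ∈ adjointGraph A T) : R e = x ∧ N e = y := by
  have hle : ‖(R e - x, N e - y)‖ ≤ ‖(0 : E)‖ := by
    refine norm_le_of_mem_graph_of_mem_adjointGraph (A := A)
      (T.graph.sub_mem (h.mem_graph e) hxy) ?_
    convert! (adjointGraph A T).sub_mem (h.mem_adjointGraph e) hy using 2
    exact (by abel : 0 - (R e - x) = e - R e - (e - x))
  simpa [sub_eq_zero] using hle

/-- The triples `(e, x, y)` with `y = T x` and `e = (1 + T⋆T) x` form a complete space, on which the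
projection `(e, x, y) ↦ e` is isometric with dense range. -/
theorem IsRegular.exists_isResolventPair [CompleteSpace E] [CompleteSpace F] {T : E →ₗ.[ℂ] F}
    (hT : IsRegular A T) : ∃ R N, IsResolventPair A T R N := by
  let W : Submodule ℂ (E × E × F) :=
    T.graph.comap (LinearMap.snd ℂ E (E × F)) ⊓ (adjointGraph A T).comap
      ((LinearMap.snd ℂ E F ∘ₗ LinearMap.snd ℂ E (E × F)).prod
        (LinearMap.fst ℂ E (E × F) - LinearMap.fst ℂ E F ∘ₗ LinearMap.snd ℂ E (E × F)))
  have isClosed_W : IsClosed (W : Set (E × E × F)) := by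
    have hTc : IsClosed (T.graph : Set (E × F)) := hT.closed
    exact (hTc.preimage continuous_snd).inter ((isClosed_adjointGraph T).preimage
      (f := fun p : E × E × F => (p.2.2, p.1 - p.2.1)) (by fun_prop))
  have : CompleteSpace W := isClosed_W.completeSpace_coe
  let proj : W →ₗᵢ[ℂ] E := ⟨LinearMap.fst ℂ E (E × F) ∘ₗ W.subtype, fun p =>
    (max_eq_left (norm_le_of_mem_graph_of_mem_adjointGraph (A := A) p.2.1 p.2.2)).symm⟩
  have denseRange_proj : DenseRange proj := hT.dense_range.mono fun e he => by
    obtain ⟨x, y, hxy, hy⟩ := (mem_range_one_add_adjoint_comp_iff hT.dense_domain).mp he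
    exact ⟨⟨(e, x, y), hxy, hy⟩, rfl⟩
  have surjective_proj : Function.Surjective proj := Set.range_eq_univ.mp
    (proj.isometry.isClosedEmbedding.isClosed_range.closure_eq ▸ denseRange_proj.closure_range)
  let e := LinearIsometryEquiv.ofSurjective proj surjective_proj
  let L : E →L[ℂ] E × E × F := W.subtypeL ∘L (e.symm : E →L[ℂ] W)
  have fst_L (v : E) : (L v).1 = v := e.apply_symm_apply v
  refine ⟨.fst ℂ E F ∘L .snd ℂ E (E × F) ∘L L, .snd ℂ E F ∘L .snd ℂ E (E × F) ∘L L,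
    fun v => (e.symm v).2.1, fun v => ?_⟩
  nth_rw 2 [← fst_L v]
  exact (e.symm v).2.2

namespace IsResolventPair

variable {T : E →ₗ.[ℂ] F} {R : E →L[ℂ] E} {N : E →L[ℂ] F}

theorem isPositive (h : IsResolventPair A T R N) : IsPositive A R := by
  have hadj : IsAdjointPair A R R := fun e e' => by
    rw [h.inner_left_eq e, ← CStarModule.star_inner (R e') e, h.inner_left_eq e', star_add,
      CStarModule.star_inner, CStarModule.star_inner]
  refine ⟨hadj, fun v => ?_⟩
  rw [← hadj, h.inner_left_eq]
  exact add_nonneg CStarModule.inner_self_nonneg CStarModule.inner_self_nonneg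

/-- For `(y', w)` in the graph of `T⋆`, the point `(R, N)(x + w)` is as close to `(x, y)` as `y'`
is to `y`. -/
theorem graph_subset_closure_range (h : IsResolventPair A T R N) (hT : IsRegular A T) :
    (T.graph : Set (E × F)) ⊆ closure (Set.range fun e => (R e, N e)) := by
  rintro ⟨x, y⟩ hxy
  refine Metric.mem_closure_iff.mpr fun ε hε => ?_
  obtain ⟨y', hy', dist_lt⟩ := Metric.mem_closure_iff.mp (hT.dense_adjoint_domain y) ε hε
  obtain ⟨w, hw⟩ := LinearPMap.mem_domain_iff.mp hy'
  rw [adjoint_graph hT.dense_domain] at hw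
  refine ⟨_, ⟨x + w, rfl⟩, lt_of_le_of_lt ?_ dist_lt⟩
  set u := R (x + w)
  set n := N (x + w)
  have hgraph : (x - u, y - n) ∈ T.graph := T.graph.sub_mem hxy (h.mem_graph _)
  have hadjoint : (n - y', x - u) ∈ adjointGraph A T := by
    convert! (adjointGraph A T).sub_mem (h.mem_adjointGraph (x + w)) hw using 2
    exact (by abel : x - u = x + w - u - w)
  rw [dist_eq_norm, dist_eq_norm, Prod.mk_sub_mk]
  refine norm_prodMk_le_of_inner_add_eq (A := A) (norm_snd_le (x - u, y - n)) ?_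
  rw [← mem_adjointGraph_iff.mp hadjoint _ _ hgraph, ← CStarModule.inner_add_right]
  congr 1
  abel

theorem denseRange_fst (h : IsResolventPair A T R N) (hT : IsRegular A T) : DenseRange R := by
  refine Dense.of_closure (hT.dense_domain.mono fun x hx => ?_)
  obtain ⟨y, hxy⟩ := LinearPMap.mem_domain_iff.mp hx
  refine map_mem_closure continuous_fst (h.graph_subset_closure_range hT hxy) ?_
  rintro _ ⟨e, rfl⟩
  exact ⟨e, rfl⟩

end IsResolventPair

end Resolvent

section Polarization

theorem eq_zero_of_isAlt {M A : Type*} [AddCommGroup M] [Module ℂ M] [AddCommGroup A] [Module ℂ A]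
    {B : M →ₗ⋆[ℂ] M →ₗ[ℂ] A} (hB : B.IsAlt) : B = 0 := by
  ext x y
  have eq_symm : B x y = B y x := by
    have := hB.neg (Complex.I • x) y
    rw [map_smulₛₗ, map_smulₛₗ, Complex.conj_I, neg_smul, LinearMap.neg_apply, neg_neg,
      LinearMap.smul_apply] at this
    exact smul_right_injective A Complex.I_ne_zero this
  have two_smul_eq_zero : (2 : ℂ) • B x y = 0 := by
    rw [two_smul, ← neg_eq_iff_add_eq_zero, hB.neg, eq_symm]
  exact (smul_eq_zero.mp two_smul_eq_zero).resolve_left two_ne_zero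

variable {A : Type*} [NonUnitalCStarAlgebra A] [PartialOrder A]
  {E F M : Type*}
  [NormedAddCommGroup E] [NormedSpace ℂ E] [SMul A E] [CStarModule A E]
  [NormedAddCommGroup F] [NormedSpace ℂ F] [SMul A F] [CStarModule A F]
  [AddCommGroup M] [Module ℂ M]

theorem inner_eq_of_inner_self_eq {f : M →ₗ[ℂ] E} {g : M →ₗ[ℂ] F}
    (h : ∀ x, inner A (f x) (f x) = inner A (g x) (g x)) (x y : M) :
    inner A (f x) (f y) = inner A (g x) (g y) := by
  let B : M →ₗ⋆[ℂ] M →ₗ[ℂ] A := LinearMap.mk₂'ₛₗ (starRingEnd ℂ) (RingHom.id ℂ)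
    (fun x y => inner A (f x) (f y) - inner A (g x) (g y))
    (fun _ _ _ => by simp; abel) (fun _ _ _ => by simp [smul_sub])
    (fun _ _ _ => by simp; abel) (fun _ _ _ => by simp [smul_sub])
  have hB : B = 0 := eq_zero_of_isAlt fun x => sub_eq_zero.mpr (h x)
  exact sub_eq_zero.mp (DFunLike.congr_fun (DFunLike.congr_fun hB x) y)

end Polarization

section ZTransform

variable {A : Type*} [NonUnitalCStarAlgebra A] [PartialOrder A]
  {E : Type*} [NormedAddCommGroup E] [NormedSpace ℂ E] [SMul A E] [CStarModule A E]

theorem Adj.inner_op_of_isSelfAdjoint {t : Adj A E} (ht : IsSelfAdjoint t) (x y : E) :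
    inner A (t.op x) y = inner A x (t.op y) := by
  rw [Adj.inner_left_eq, ht.star_eq]

theorem Adj.op_comm {a b : Adj A E} (h : Commute a b) (v : E) : a.op (b.op v) = b.op (a.op v) :=
  Adj.congr_op h.eq v

variable [StarOrderedRing A]

theorem norm_le_of_norm_inner_le {X : Type*} {p : X → E} (hp : DenseRange p) {w : E} {C : ℝ}
    (hC : 0 ≤ C) (h : ∀ x, ‖inner A (p x) w‖ ≤ ‖p x‖ * C) : ‖w‖ ≤ C := by
  have norm_sq_le : ‖w‖ * ‖w‖ ≤ ‖w‖ * C := by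
    rw [← sq, CStarModule.norm_sq_eq A]
    exact hp.induction_on (p := fun x => ‖inner A x w‖ ≤ ‖x‖ * C) w
      (isClosed_le (continuous_inner_of_continuous continuous_id continuous_const).norm
        (by fun_prop)) h
  rcases eq_or_ne w 0 with rfl | hw
  · rwa [norm_zero]
  · exact le_of_mul_le_mul_left norm_sq_le (norm_pos_iff.mpr hw)

theorem IsNormal.exists_mem_graph_mem_adjointGraph {T : E →ₗ.[ℂ] E} (hT : IsNormal A T)
    {y w v : E} (hyw : (y, w) ∈ adjointGraph A T) (hwv : (w, v) ∈ T.graph) :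
    ∃ t, (y, t) ∈ T.graph ∧ (t, v) ∈ adjointGraph A T := by
  let T' : T.domain →ₗ[ℂ] E := (adjoint A T).toFun ∘ₗ Submodule.inclusion hT.domain_eq.le
  have mem_adjointGraph (u : T.domain) : ((u : E), T' u) ∈ adjointGraph A T := by
    rw [← adjoint_graph hT.regular.dense_domain]
    exact LinearPMap.mem_graph (adjoint A T) (Submodule.inclusion hT.domain_eq.le u)
  have inner_eq (u u' : T.domain) : inner A (T u) (T u') = inner A (T' u) (T' u') :=
    inner_eq_of_inner_self_eq (f := T.toFun) (fun u => hT.inner_eq u _ rfl) u u'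
  rw [← adjoint_graph hT.regular.dense_domain] at hyw
  have hy : y ∈ T.domain := hT.domain_eq ▸ LinearPMap.mem_domain_of_mem_graph hyw
  obtain rfl : T' ⟨y, hy⟩ = w := LinearPMap.mem_graph_snd_inj _
    (LinearPMap.mem_graph (adjoint A T) (Submodule.inclusion hT.domain_eq.le ⟨y, hy⟩)) hyw rfl
  refine ⟨T ⟨y, hy⟩, LinearPMap.mem_graph T ⟨y, hy⟩, fun u => ?_⟩
  rw [inner_eq, ← CStarModule.star_inner _ (T' u),
    ← HilbertModule.mem_adjointGraph_iff.mp (mem_adjointGraph u) _ _ hwv, CStarModule.star_inner]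

variable [CompleteSpace E]

/-- `z` is the `z`-transform of `T` and `q = (1 - z⋆z)^{1/2}`, as elements of the C⋆-algebra
`𝓛(E)`. -/
structure IsZPair (T : E →ₗ.[ℂ] E) (z q : Adj A E) : Prop where
  norm_le : ‖z‖ ≤ 1
  nonneg : 0 ≤ q
  sq : q * q = 1 - star z * z
  mem_graph_iff : ∀ x y, (x, y) ∈ T.graph ↔ ∃ v, q.op v = x ∧ z.op v = y

theorem IsRegular.exists_isResolventPair_mul_self {T : E →ₗ.[ℂ] E} (hT : IsRegular A T) :
    ∃ (q : Adj A E) (N : E →L[ℂ] E), 0 ≤ q ∧ DenseRange q.op ∧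
      IsResolventPair A T (q * q).op N := by
  obtain ⟨R, N, h⟩ := hT.exists_isResolventPair
  let R' : Adj A E := Adj.mk h.isPositive.1
  have hR' : 0 ≤ R' := Adj.isPositive_op_iff.mp h.isPositive
  have sqrt_mul : CFC.sqrt R' * CFC.sqrt R' = R' := CFC.sqrt_mul_sqrt_self R' hR'
  refine ⟨CFC.sqrt R', N, CFC.sqrt_nonneg R', ?_, by rwa [sqrt_mul]⟩
  refine (h.denseRange_fst hT).mono ?_
  rintro _ ⟨e, rfl⟩
  exact ⟨(CFC.sqrt R').op e, Adj.congr_op sqrt_mul e⟩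

namespace IsResolventPair

variable {T : E →ₗ.[ℂ] E} {q z : Adj A E} {N : E →L[ℂ] E}

theorem norm_snd_le (h : IsResolventPair A T (q * q).op N) (hq : 0 ≤ q) (e : E) :
    ‖N e‖ ≤ ‖q.op e‖ := by
  refine norm_le_of_inner_le (A := A) ?_
  rw [Adj.inner_op_of_isSelfAdjoint (.of_nonneg hq), ← Adj.mul_op, ← h.isPositive.1,
    h.inner_left_eq]
  exact le_add_of_nonneg_left CStarModule.inner_self_nonneg

theorem exists_op_eq_snd (h : IsResolventPair A T (q * q).op N) (hT : IsRegular A T)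
    (hq : 0 ≤ q) (hd : DenseRange q.op) : ∃ z : Adj A E, ‖z‖ ≤ 1 ∧ ∀ e, z.op (q.op e) = N e := by
  have inner_snd (e : E) (v : (adjoint A T).domain) :
      inner A (N e) (v : E) = inner A (q.op e) (q.op (adjoint A T v)) := by
    rw [mem_adjointGraph_iff.mp (adjoint_graph (A := A) hT.dense_domain ▸
      LinearPMap.mem_graph (adjoint A T) v) _ _ (h.mem_graph e), Adj.mul_op,
      Adj.inner_op_of_isSelfAdjoint (.of_nonneg hq)]
  have norm_adjoint_le (v : (adjoint A T).domain) : ‖q.op (adjoint A T v)‖ ≤ ‖(v : E)‖ :=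
    norm_le_of_norm_inner_le (A := A) hd (norm_nonneg _) fun e => by
      rw [← inner_snd]
      refine (CStarModule.norm_inner_le E).trans ?_
      gcongr
      exact h.norm_snd_le hq e
  obtain ⟨z, norm_z, hz, -⟩ := exists_adjointable_extension (A := A)
    (p := q.op.toLinearMap) (m := N.toLinearMap) (p' := (adjoint A T).domain.subtype)
    (m' := q.op.toLinearMap ∘ₗ (adjoint A T).toFun) hd hT.dense_adjoint_domain.denseRange_val
    (h.norm_snd_le hq) norm_adjoint_le inner_snd
  exact ⟨z, norm_z, hz⟩

theorem mul_self_eq (h : IsResolventPair A T (q * q).op N) (hq : 0 ≤ q) (hd : DenseRange q.op)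
    (hz : ∀ e, z.op (q.op e) = N e) : q * q = 1 - star z * z := by
  refine eq_of_mul_eq_of_denseRange hd (Adj.ext fun e => ?_)
  refine ext_inner_left_of_denseRange A hd fun e' => ?_
  have inner_snd : inner A (N e') (N e) = inner A (q.op e') (q.op (e - q.op (q.op e))) := by
    rw [mem_adjointGraph_iff.mp (h.mem_adjointGraph e) _ _ (h.mem_graph e'), Adj.mul_op,
      Adj.inner_op_of_isSelfAdjoint (.of_nonneg hq), Adj.mul_op]
  simp only [Adj.sub_op, Adj.mul_op, Adj.one_op, CStarModule.inner_sub_right,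
    ← Adj.inner_left_eq, hz, inner_snd, map_sub, sub_sub_cancel]

theorem graph_eq_range (h : IsResolventPair A T (q * q).op N) (hT : IsRegular A T)
    (hq : 0 ≤ q) (hd : DenseRange q.op) (hz : ∀ e, z.op (q.op e) = N e) :
    (T.graph : Set (E × E)) = Set.range fun v => (q.op v, z.op v) := by
  have isClosed_range : IsClosed (Set.range fun v => (q.op v, z.op v)) := by
    have leftInverse : Function.LeftInverse (fun p : E × E => q.op p.1 + (star z).op p.2)
        fun v => (q.op v, z.op v) := fun v => by
      simpa [eq_sub_iff_add_eq] using Adj.congr_op (h.mul_self_eq hq hd hz) v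
    exact leftInverse.isClosed_range (by fun_prop) (by fun_prop)
  apply subset_antisymm
  · refine (h.graph_subset_closure_range hT).trans (isClosed_range.closure_subset_iff.mpr ?_)
    rintro _ ⟨e, rfl⟩
    exact ⟨q.op e, Prod.ext rfl (hz e)⟩
  · rintro _ ⟨v, rfl⟩
    have isClosed_preimage : IsClosed {v | (q.op v, z.op v) ∈ T.graph} :=
      IsClosed.preimage (t := (T.graph : Set (E × E))) (by fun_prop) hT.closed
    refine hd.induction_on (p := fun v => (q.op v, z.op v) ∈ T.graph) v isClosed_preimage
      fun e => ?_
    rw [hz]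
    exact h.mem_graph e

end IsResolventPair

theorem IsRegular.exists_isZPair {T : E →ₗ.[ℂ] E} (hT : IsRegular A T) :
    ∃ z q : Adj A E, IsZPair T z q ∧ DenseRange q.op := by
  obtain ⟨q, N, hq, hd, h⟩ := hT.exists_isResolventPair_mul_self
  obtain ⟨z, norm_z, hz⟩ := h.exists_op_eq_snd hT hq hd
  refine ⟨z, q, ⟨norm_z, hq, h.mul_self_eq hq hd hz, fun x y => ?_⟩, hd⟩
  rw [← SetLike.mem_coe, h.graph_eq_range hT hq hd hz]
  simp

namespace IsZPair

variable {T : E →ₗ.[ℂ] E} {z q : Adj A E}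

theorem isSelfAdjoint (h : IsZPair T z q) : IsSelfAdjoint q := .of_nonneg h.nonneg

theorem add_eq (h : IsZPair T z q) (v : E) : q.op (q.op v) + (star z).op (z.op v) = v := by
  simpa [eq_sub_iff_add_eq] using Adj.congr_op h.sq v

theorem injective (h : IsZPair T z q) : Function.Injective q.op := by
  refine (injective_iff_map_eq_zero _).mpr fun v hv => ?_
  have z_v : z.op v = 0 :=
    LinearPMap.graph_fst_eq_zero_snd T ((h.mem_graph_iff 0 _).mpr ⟨v, hv, rfl⟩) rfl
  rw [← h.add_eq v, hv, z_v, map_zero, map_zero, add_zero]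

theorem domain_eq (h : IsZPair T z q) : (T.domain : Set E) = Set.range q.op := by
  ext x
  rw [SetLike.mem_coe, LinearPMap.mem_domain_iff]
  simp only [h.mem_graph_iff]
  exact ⟨fun ⟨_, v, hv, _⟩ => ⟨v, hv⟩, fun ⟨v, hv⟩ => ⟨_, v, hv, rfl⟩⟩

theorem mem_adjointGraph_iff (h : IsZPair T z q) {v w : E} :
    (v, w) ∈ adjointGraph A T ↔ (star z).op v = q.op w := by
  rw [HilbertModule.mem_adjointGraph_iff]
  constructor
  · intro hvw
    refine ext_inner_left A fun u => ?_
    rw [← Adj.inner_left_eq, ← Adj.inner_op_of_isSelfAdjoint h.isSelfAdjoint]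
    exact hvw _ _ ((h.mem_graph_iff _ _).mpr ⟨u, rfl, rfl⟩)
  · intro hvw x y hxy
    obtain ⟨u, rfl, rfl⟩ := (h.mem_graph_iff _ _).mp hxy
    rw [Adj.inner_left_eq, hvw, Adj.inner_op_of_isSelfAdjoint h.isSelfAdjoint]

theorem isResolventPair (h : IsZPair T z q) : IsResolventPair A T (q * q).op (z * q).op where
  mem_graph e := (h.mem_graph_iff _ _).mpr ⟨q.op e, rfl, rfl⟩
  mem_adjointGraph e := by
    rw [h.mem_adjointGraph_iff, Adj.mul_op, Adj.mul_op, map_sub, eq_sub_iff_add_eq', h.add_eq]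

theorem unique {z' q' : Adj A E} (h : IsZPair T z q) (h' : IsZPair T z' q') : z' = z := by
  have mul_self_eq : q * q = q' * q' := Adj.ext fun e =>
    (h.isResolventPair.eq_of_mem (h'.isResolventPair.mem_graph e)
      (h'.isResolventPair.mem_adjointGraph e)).1
  obtain rfl := (CFC.mul_self_eq_mul_self_iff q q' h.nonneg h'.nonneg).mp mul_self_eq
  refine Adj.ext fun v => ?_
  obtain ⟨w, q_w, z_w⟩ := (h.mem_graph_iff _ _).mp ((h'.mem_graph_iff _ _).mpr ⟨v, rfl, rfl⟩)
  rw [← z_w, h.injective q_w]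

theorem isZTransform (h : IsZPair T z q) : IsZTransform A T z.op := by
  refine ⟨h.norm_le, (star z).op, q.op, Adj.isAdjointPair_star z,
    Adj.isPositive_op_iff.mpr h.nonneg, ContinuousLinearMap.ext (Adj.congr_op h.sq), ?_⟩
  ext ⟨x, y⟩
  rw [h.mem_graph_iff, LinearMap.mem_range]
  simp

theorem of_isZTransform {t : E →L[ℂ] E} (h : IsZTransform A T t) :
    ∃ z q : Adj A E, z.op = t ∧ IsZPair T z q := by
  obtain ⟨norm_t, s, r, hs, hr, sq, graph_eq⟩ := h
  let q : Adj A E := Adj.mk hr.1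
  refine ⟨Adj.mk hs, q, rfl, norm_t, Adj.isPositive_op_iff.mp hr, Adj.ext fun v => ?_,
    fun x y => ?_⟩
  · rw [Adj.sub_op, Adj.mul_op (star _), Adj.op_star_eq (t := Adj.mk hs) hs]
    exact DFunLike.congr_fun sq v
  · rw [graph_eq, LinearMap.mem_range]
    exact exists_congr fun v => Prod.mk.injEq .. ▸ Iff.rfl

/-- As `T T⋆ ⊆ T⋆T`, the element `y = (1 - zz⋆) e` solves `(1 + T⋆T) y = e`, an equation whose
solution is `(1 - z⋆z) e`. -/
theorem isStarNormal (h : IsZPair T z q) (hT : IsNormal A T) : IsStarNormal z := by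
  refine ⟨Adj.ext fun e => ?_⟩
  have mem_adjointGraph : (e - z.op ((star z).op e), q.op ((star z).op e)) ∈ adjointGraph A T := by
    rw [h.mem_adjointGraph_iff, map_sub, sub_eq_iff_eq_add, h.add_eq]
  obtain ⟨y, hy, hy'⟩ := hT.exists_mem_graph_mem_adjointGraph mem_adjointGraph
    ((h.mem_graph_iff _ _).mpr ⟨(star z).op e, rfl, rfl⟩)
  have sq_e := (h.isResolventPair.eq_of_mem hy (e := e) (by rwa [sub_sub_cancel])).1
  simpa [h.sq] using sq_e

theorem commute (h : IsZPair T z q) (hz : IsStarNormal z) : Commute z q := by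
  have intertwines : Intertwines z.op (q * q) (q * q) := fun v => by
    have commute_mul_self : Commute z (q * q) := by
      rw [h.sq]
      exact (Commute.one_right z).sub_right (hz.star_comm_self.symm.mul_right (.refl z))
    exact Adj.op_comm commute_mul_self v
  exact Adj.ext (intertwines.of_mul_self h.nonneg h.nonneg)

theorem commute_star (h : IsZPair T z q) (hz : IsStarNormal z) : Commute (star z) q := by
  simpa [h.isSelfAdjoint.star_eq] using (h.commute hz).star_star

theorem add_eq' (h : IsZPair T z q) (hz : IsStarNormal z) (v : E) :
    q.op (q.op v) + z.op ((star z).op v) = v := by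
  rw [← Adj.op_comm hz.star_comm_self, h.add_eq]

theorem mem_graph_iff' (h : IsZPair T z q) (hz : IsStarNormal z) {x y : E} :
    (x, y) ∈ T.graph ↔ z.op x = q.op y := by
  rw [h.mem_graph_iff]
  constructor
  · rintro ⟨v, rfl, rfl⟩
    exact Adj.op_comm (h.commute hz) v
  · intro hxy
    refine ⟨q.op x + (star z).op y, ?_, ?_⟩
    · rw [map_add, ← Adj.op_comm (h.commute_star hz), ← hxy, h.add_eq]
    · rw [map_add, Adj.op_comm (h.commute hz), hxy, h.add_eq' hz]

theorem mem_adjointGraph_iff' (h : IsZPair T z q) (hz : IsStarNormal z) {x y : E} :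
    (x, y) ∈ adjointGraph A T ↔ ∃ v, q.op v = x ∧ (star z).op v = y := by
  rw [h.mem_adjointGraph_iff]
  constructor
  · intro hxy
    refine ⟨q.op x + z.op y, ?_, ?_⟩
    · rw [map_add, ← Adj.op_comm (h.commute hz), ← hxy, h.add_eq' hz]
    · rw [map_add, Adj.op_comm (h.commute_star hz), hxy, h.add_eq]
  · rintro ⟨v, rfl, rfl⟩
    exact Adj.op_comm (h.commute_star hz) v

theorem isRegular (h : IsZPair T z q) (hz : IsStarNormal z) (hd : DenseRange q.op) :
    IsRegular A T := by
  have dense_domain : Dense (T.domain : Set E) := h.domain_eq ▸ hd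
  refine ⟨dense_domain, isModuleMap_of_smul_mem_graph fun a x y hxy => ?_, ?_, ?_, ?_⟩
  · obtain ⟨v, rfl, rfl⟩ := (h.mem_graph_iff _ _).mp hxy
    exact (h.mem_graph_iff _ _).mpr ⟨a • v, (Adj.isAdjointPair_star q).map_smul a v,
      (Adj.isAdjointPair_star z).map_smul a v⟩
  · have graph_eq : (T.graph : Set (E × E)) = {p | z.op p.1 = q.op p.2} :=
      Set.ext fun p => h.mem_graph_iff' hz
    change IsClosed (T.graph : Set (E × E))
    rw [graph_eq]
    exact isClosed_eq (by fun_prop) (by fun_prop)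
  · refine hd.mono ?_
    rintro _ ⟨v, rfl⟩
    rw [SetLike.mem_coe, LinearPMap.mem_domain_iff, adjoint_graph dense_domain]
    exact ⟨_, (h.mem_adjointGraph_iff' hz).mpr ⟨v, rfl, rfl⟩⟩
  · exact Function.Surjective.denseRange fun e =>
      (mem_range_one_add_adjoint_comp_iff dense_domain).mpr
        ⟨_, _, h.isResolventPair.mem_graph e, h.isResolventPair.mem_adjointGraph e⟩

end IsZPair

theorem IsNormal.exists_isZPair {T : E →ₗ.[ℂ] E} (hT : IsNormal A T) :
    ∃ z q : Adj A E, IsZPair T z q ∧ IsStarNormal z ∧ DenseRange q.op := by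
  obtain ⟨z, q, h, hd⟩ := hT.regular.exists_isZPair
  exact ⟨z, q, h, h.isStarNormal hT, hd⟩

theorem exists_isZPair {z : Adj A E} (hz : ‖z‖ ≤ 1) (hd : DenseRange (1 - star z * z).op) :
    ∃ (T : E →ₗ.[ℂ] E) (q : Adj A E), IsZPair T z q ∧ DenseRange q.op := by
  have nonneg : 0 ≤ 1 - star z * z := by
    rw [sub_nonneg, ← CStarAlgebra.norm_le_one_iff_of_nonneg _ (star_mul_self_nonneg z),
      CStarRing.norm_star_mul_self]
    exact mul_le_one₀ hz (norm_nonneg z) hz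
  let q := CFC.sqrt (1 - star z * z)
  have sq : q * q = 1 - star z * z := CFC.sqrt_mul_sqrt_self _ nonneg
  have hdq : DenseRange q.op := by
    rw [← sq] at hd
    exact hd.mono (Set.range_comp_subset_range q.op q.op)
  refine ⟨(LinearMap.range (q.op.toLinearMap.prod z.op.toLinearMap)).toLinearPMap, q,
    ⟨hz, CFC.sqrt_nonneg _, sq, fun x y => ?_⟩, hdq⟩
  rw [Submodule.toLinearPMap_graph_eq, LinearMap.mem_range]
  · simp
  · rintro _ ⟨v, rfl⟩ hv
    have v_eq : v = 0 := eq_zero_of_denseRange_star (a := q)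
      (by rwa [(IsSelfAdjoint.of_nonneg (CFC.sqrt_nonneg _)).star_eq]) hv
    rw [v_eq, map_zero, Prod.snd_zero]

end ZTransform

section Fuglede

section Graph

variable {E F : Type*} [NormedAddCommGroup E] [NormedSpace ℂ E] [NormedAddCommGroup F]
  [NormedSpace ℂ F] {U : E →L[ℂ] F} {S : E →ₗ.[ℂ] E} {T : F →ₗ.[ℂ] F} {x : E} {y : F}

theorem mem_graph_toP : (x, y) ∈ (toP U).graph ↔ U x = y := by
  rw [LinearPMap.mem_graph_iff]
  constructor
  · rintro ⟨u, rfl, rfl⟩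
    rfl
  · rintro rfl
    exact ⟨⟨x, trivial⟩, rfl, rfl⟩

theorem mem_graph_toP_pcomp :
    (x, y) ∈ (pcomp (toP U) S).graph ↔ ∃ w, (x, w) ∈ S.graph ∧ U w = y := by
  simp only [mem_graph_pcomp, mem_graph_toP]

theorem mem_graph_pcomp_toP : (x, y) ∈ (pcomp T (toP U)).graph ↔ (U x, y) ∈ T.graph := by
  simp only [mem_graph_pcomp, mem_graph_toP, exists_eq_left']

theorem pcomp_toP_le_iff :
    pcomp (toP U) S ≤ pcomp T (toP U) ↔ ∀ x y, (x, y) ∈ S.graph → (U x, U y) ∈ T.graph := by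
  rw [← LinearPMap.le_graph_iff]
  constructor
  · exact fun h x y hxy => mem_graph_pcomp_toP.mp (h (mem_graph_toP_pcomp.mpr ⟨y, hxy, rfl⟩))
  · rintro h ⟨x, y⟩ hxy
    obtain ⟨w, hw, rfl⟩ := mem_graph_toP_pcomp.mp hxy
    exact mem_graph_pcomp_toP.mpr (h x w hw)

end Graph

/-- `c` is a cut-off of `q`: a function of `q` supported where `q` has the bounded inverse `k`. -/
structure IsCutoff {B : Type*} [Ring B] [Star B] (q k c : B) : Prop where
  isSelfAdjoint : IsSelfAdjoint k
  commute_inv : ∀ b, Commute q b → Commute k b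
  commute : ∀ b, Commute q b → Commute c b
  mul_mul_eq : q * k * c = c

section Cutoff

variable {B : Type*} [CStarAlgebra B]

theorem mem_closure_isCutoff [PartialOrder B] [StarOrderedRing B] {q : B} (hq : 0 ≤ q) :
    q ∈ closure {c | ∃ k, IsCutoff q k c} := by
  refine Metric.mem_closure_iff.mpr fun ε hε => ?_
  have hsa : IsSelfAdjoint q := .of_nonneg hq
  let φ : ℝ → ℝ := fun x => max (x - ε / 2) 0
  let ψ : ℝ → ℝ := fun x => (max x (ε / 2))⁻¹
  have max_pos (x : ℝ) : 0 < max x (ε / 2) := lt_max_of_lt_right (half_pos hε)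
  have hφ : Continuous φ := by fun_prop
  have hψ : Continuous ψ :=
    Continuous.inv₀ (by fun_prop) fun x => (max_pos x).ne'
  have id_mul_mul (x : ℝ) : x * ψ x * φ x = φ x := by
    rcases le_total x (ε / 2) with hx | hx
    · simp only [φ, max_eq_right (sub_nonpos.mpr hx), mul_zero]
    · simp only [ψ, max_eq_left hx, mul_inv_cancel₀ ((half_pos hε).trans_le hx).ne', one_mul]
  refine ⟨cfc φ q, ⟨cfc ψ q, cfc_predicate ψ q, fun b hb => hb.cfc_real ψ,
    fun b hb => hb.cfc_real φ, ?_⟩, lt_of_le_of_lt ?_ (half_lt_self hε)⟩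
  · calc q * cfc ψ q * cfc φ q = cfc (fun x => x) q * cfc ψ q * cfc φ q := by rw [cfc_id' ℝ q]
      _ = cfc (fun x => x * ψ x * φ x) q := by
        rw [cfc_mul (fun x => x * ψ x) φ q (continuous_id.mul hψ).continuousOn hφ.continuousOn,
          cfc_mul (fun x => x) ψ q continuousOn_id hψ.continuousOn]
      _ = cfc φ q := by simp only [id_mul_mul]
  · calc dist q (cfc φ q) = ‖cfc (fun x => x - φ x) q‖ := by
          rw [cfc_sub (fun x => x) φ q continuousOn_id hφ.continuousOn, cfc_id' ℝ q, dist_eq_norm]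
      _ ≤ ε / 2 := norm_cfc_le (half_pos hε).le fun x hx => by
          have := spectrum_nonneg_of_nonneg hq hx
          rw [Real.norm_eq_abs, abs_le]
          simp only [φ]
          rcases le_total x (ε / 2) with hx | hx
          · rw [max_eq_right (sub_nonpos.mpr hx)]
            constructor <;> linarith
          · rw [max_eq_left (sub_nonneg.mpr hx)]
            constructor <;> linarith

theorem isStarNormal_mul {z k : B} (hz : IsStarNormal z) (hk : IsSelfAdjoint k)
    (h : Commute k z) (h' : Commute k (star z)) : IsStarNormal (z * k) := by
  refine ⟨?_⟩
  rw [star_mul, hk.star_eq]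
  exact (h.mul_right (.refl k)).mul_left (hz.star_comm_self.mul_right h'.symm)

end Cutoff

variable {A : Type*} [NonUnitalCStarAlgebra A] [PartialOrder A] [StarOrderedRing A]
  {E F : Type*} [NormedAddCommGroup E] [NormedSpace ℂ E] [SMul A E] [CStarModule A E]
  [CompleteSpace E] [NormedAddCommGroup F] [NormedSpace ℂ F] [SMul A F] [CStarModule A F]
  [CompleteSpace F] {U : E →L[ℂ] F} {z q : Adj A E} {z' q' : Adj A F}

/-- Both cut-offs turn the unbounded quotients of `z` by `q` and of `z'` by `q'` into bounded normal
elements `z * k` and `z' * k'`, to which the bounded theorem applies. -/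
theorem IsCutoff.star_op_eq {k c : Adj A E} {k' c' : Adj A F} (hc : IsCutoff q k c)
    (hc' : IsCutoff q' k' c') (hz : IsStarNormal z) (hz' : IsStarNormal z') (hqz : Commute q z)
    (hqz_star : Commute q (star z)) (hqz' : Commute q' z') (hqz'_star : Commute q' (star z'))
    (h : ∀ v, z'.op (U (q.op v)) = q'.op (U (z.op v))) (v : E) :
    c'.op ((star z').op (U (q.op (c.op v)))) = c'.op (q'.op (U ((star z).op (c.op v)))) := by
  have mul_c (v : E) : q.op (k.op (c.op v)) = c.op v := Adj.congr_op hc.mul_mul_eq v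
  have mul_c' (w : F) : q'.op (k'.op (c'.op w)) = c'.op w := Adj.congr_op hc'.mul_mul_eq w
  have hck := hc.commute k (hc.commute_inv q (.refl q)).symm
  have hcq := hc.commute q (.refl q)
  have hcq' := hc'.commute q' (.refl q')
  have intertwines : Intertwines (c'.op.comp (U.comp c.op)) (z * k) (z' * k') := fun v => by
    simp only [ContinuousLinearMap.comp_apply, Adj.mul_op]
    calc c'.op (U (c.op (z.op (k.op v))))
        = c'.op (U (z.op (k.op (c.op v)))) := by
          rw [Adj.op_comm (hc.commute z hqz), Adj.op_comm hck]
      _ = q'.op (k'.op (c'.op (U (z.op (k.op (c.op v)))))) := (mul_c' _).symm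
      _ = k'.op (c'.op (q'.op (U (z.op (k.op (c.op v)))))) := by
          rw [← Adj.op_comm (hc'.commute_inv q' (.refl q')), Adj.op_comm hcq']
      _ = k'.op (c'.op (z'.op (U (q.op (k.op (c.op v)))))) := by rw [h]
      _ = z'.op (k'.op (c'.op (U (c.op v)))) := by
          rw [mul_c, Adj.op_comm (hc'.commute z' hqz'), Adj.op_comm (hc'.commute_inv z' hqz')]
  have intertwines_star := intertwines.star
    (isStarNormal_mul hz hc.isSelfAdjoint (hc.commute_inv z hqz) (hc.commute_inv _ hqz_star))
    (isStarNormal_mul hz' hc'.isSelfAdjoint (hc'.commute_inv z' hqz')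
      (hc'.commute_inv _ hqz'_star)) (q.op v)
  simp only [star_mul, hc.isSelfAdjoint.star_eq, hc'.isSelfAdjoint.star_eq,
    ContinuousLinearMap.comp_apply, Adj.mul_op] at intertwines_star
  calc c'.op ((star z').op (U (q.op (c.op v))))
      = q'.op (k'.op ((star z').op (c'.op (U (c.op (q.op v)))))) := by
        rw [Adj.op_comm hcq, ← Adj.op_comm (hc'.commute _ hqz'_star), mul_c']
    _ = q'.op (c'.op (U (c.op (k.op ((star z).op (q.op v)))))) := by rw [intertwines_star]
    _ = c'.op (q'.op (U ((star z).op (c.op v)))) := by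
        rw [Adj.op_comm hcq', ← Adj.op_comm hqz_star, Adj.op_comm hck,
          Adj.op_comm hcq, Adj.op_comm (hc.commute_inv q (.refl q)), mul_c,
          Adj.op_comm (hc.commute _ hqz_star)]

theorem op_apply_op_eq_zero_of_forall_isCutoff (hq : 0 ≤ q) (hq' : 0 ≤ q') {D : E →L[ℂ] F}
    (hD : ∀ k c k' c', IsCutoff q k c → IsCutoff q' k' c' → ∀ v, c'.op (D (c.op v)) = 0) (v : E) :
    q'.op (D (q.op v)) = 0 := by
  have isClosed : IsClosed {p : Adj A E × Adj A F | p.2.op (D (p.1.op v)) = 0} := by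
    have continuous_op_fst : Continuous fun p : Adj A E × Adj A F => p.1.op v :=
      (Adj.continuous_op.comp continuous_fst).clm_apply continuous_const
    have continuous_op_snd : Continuous fun p : Adj A E × Adj A F => p.2.op :=
      Adj.continuous_op.comp continuous_snd
    have continuous_op_D_op : Continuous fun p : Adj A E × Adj A F => p.2.op (D (p.1.op v)) :=
      continuous_op_snd.clm_apply (D.continuous.comp continuous_op_fst)
    exact isClosed_eq continuous_op_D_op continuous_const
  have mem_closure :
      (q, q') ∈ closure ({c | ∃ k, IsCutoff q k c} ×ˢ {c | ∃ k, IsCutoff q' k c}) := by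
    rw [closure_prod_eq]
    exact ⟨mem_closure_isCutoff hq, mem_closure_isCutoff hq'⟩
  refine closure_minimal ?_ isClosed mem_closure
  rintro ⟨c, c'⟩ ⟨⟨k, hc⟩, k', hc'⟩
  exact hD k c k' c' hc hc' v

section IsZPair

variable {S : E →ₗ.[ℂ] E} {T : F →ₗ.[ℂ] F}

theorem IsZPair.star_op_eq (hS : IsZPair S z q) (hT : IsZPair T z' q') (hz : IsStarNormal z)
    (hz' : IsStarNormal z') (hd : DenseRange q.op)
    (h : ∀ v, z'.op (U (q.op v)) = q'.op (U (z.op v))) (v : E) :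
    (star z').op (U (q.op v)) = q'.op (U ((star z).op v)) := by
  let D : E →L[ℂ] F := (star z').op.comp (U.comp q.op) - q'.op.comp (U.comp (star z).op)
  have D_op_eq_zero (u : E) : D (q.op u) = 0 := by
    refine hT.injective ((op_apply_op_eq_zero_of_forall_isCutoff hS.nonneg hT.nonneg
      (fun k c k' c' hc hc' v => ?_) u).trans (map_zero _).symm)
    exact (map_sub _ _ _).trans <| sub_eq_zero.mpr <| hc.star_op_eq hc' hz hz'
      (hS.commute hz).symm (hS.commute_star hz).symm (hT.commute hz').symm
      (hT.commute_star hz').symm h v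
  have D_eq_zero : ⇑D = 0 := hd.equalizer D.continuous continuous_const (funext D_op_eq_zero)
  exact sub_eq_zero.mp (congrFun D_eq_zero v)

theorem IsZPair.intertwines (hS : IsZPair S z q) (hT : IsZPair T z' q') (hz : IsStarNormal z)
    (hz' : IsStarNormal z') (hd : DenseRange q.op)
    (h : ∀ v, z'.op (U (q.op v)) = q'.op (U (z.op v))) :
    Intertwines U q q' ∧ Intertwines U z z' ∧ Intertwines U (star z) (star z') := by
  have h_star := hS.star_op_eq hT hz hz' hd h
  have intertwines_sq : Intertwines U (q * q) (q' * q') := fun v => by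
    have star_mul_self_op : (star z').op (z'.op (U (q.op (q.op v)))) =
        q'.op (q'.op (U ((star z).op (z.op v)))) := by
      rw [h, Adj.op_comm (hT.commute_star hz'), Adj.op_comm (hS.commute hz), h_star]
    have add_eq := hT.add_eq (U (q.op (q.op v)))
    rw [star_mul_self_op, ← map_add, ← map_add, ← map_add, hS.add_eq] at add_eq
    exact add_eq.symm
  have intertwines_q : Intertwines U q q' := .of_mul_self hS.nonneg hT.nonneg intertwines_sq
  refine ⟨intertwines_q, fun v => ?_, fun v => ?_⟩
  · refine hd.induction_on (p := fun v => U (z.op v) = z'.op (U v)) v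
      (isClosed_eq (by fun_prop) (by fun_prop)) fun u => ?_
    rw [h, Adj.op_comm (hS.commute hz), intertwines_q]
  · refine hd.induction_on (p := fun v => U ((star z).op v) = (star z').op (U v)) v
      (isClosed_eq (by fun_prop) (by fun_prop)) fun u => ?_
    rw [h_star, Adj.op_comm (hS.commute_star hz), intertwines_q]

theorem IsZPair.intertwines_of_pcomp_le (hS : IsZPair S z q) (hT : IsZPair T z' q')
    (hz : IsStarNormal z) (hz' : IsStarNormal z') (hd : DenseRange q.op)
    (h : pcomp (toP U) S ≤ pcomp T (toP U)) :
    Intertwines U q q' ∧ Intertwines U z z' ∧ Intertwines U (star z) (star z') :=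
  hS.intertwines hT hz hz' hd fun v => (hT.mem_graph_iff' hz').mp
    (pcomp_toP_le_iff.mp h _ _ ((hS.mem_graph_iff _ _).mpr ⟨v, rfl, rfl⟩))

end IsZPair

theorem pcomp_adjoint_le {S : E →ₗ.[ℂ] E} {T : F →ₗ.[ℂ] F} (hS : IsNormal A S)
    (hT : IsNormal A T) (h : pcomp (toP U) S ≤ pcomp T (toP U)) :
    pcomp (toP U) (adjoint A S) ≤ pcomp (adjoint A T) (toP U) := by
  obtain ⟨z, q, hSz, hz, hd⟩ := hS.exists_isZPair
  obtain ⟨z', q', hTz, hz', -⟩ := hT.exists_isZPair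
  obtain ⟨intertwines_q, -, intertwines_star⟩ := hSz.intertwines_of_pcomp_le hTz hz hz' hd h
  refine pcomp_toP_le_iff.mpr fun x y hxy => ?_
  rw [adjoint_graph hS.regular.dense_domain, hSz.mem_adjointGraph_iff] at hxy
  rw [adjoint_graph hT.regular.dense_domain, hTz.mem_adjointGraph_iff, ← intertwines_star,
    ← intertwines_q, hxy]

end Fuglede

section Values

variable {A : Type*} [NonUnitalCStarAlgebra A] [PartialOrder A] [StarOrderedRing A]
  {E : Type*} [NormedAddCommGroup E] [NormedSpace ℂ E] [SMul A E] [CStarModule A E]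
  [CompleteSpace E] {a t : Adj A E} {φ h χ : ℂ → ℂ}

theorem mul_cfc_of_mul_cfc (hd : DenseRange (cfc h a).op) (hh : ContinuousOn h (spectrum ℂ a))
    (hφh : ContinuousOn (fun x => φ x * h x) (spectrum ℂ a)) (hχ : ContinuousOn χ (spectrum ℂ a))
    (hφχ : ContinuousOn (fun x => φ x * χ x) (spectrum ℂ a))
    (ht : t * cfc h a = cfc (fun x => φ x * h x) a) :
    t * cfc χ a = cfc (fun x => φ x * χ x) a := by
  refine eq_of_mul_eq_of_denseRange hd ?_
  rw [mul_assoc, (cfc_commute_cfc χ h a).eq, ← mul_assoc, ht, ← cfc_mul _ _ a hφh hχ,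
    ← cfc_mul _ _ a hφχ hh]
  congr! 2 with x
  ring

theorem star_mul_cfc_of_mul_cfc (hd : DenseRange (cfc h a).op)
    (hh : ContinuousOn h (spectrum ℂ a)) (hφ : ContinuousOn φ (spectrum ℂ a ∩ {x | h x ≠ 0}))
    (norm_φ_le : ∀ x ∈ spectrum ℂ a, ‖φ x‖ ≤ 1)
    (ht : t * cfc h a = cfc (fun x => φ x * h x) a) :
    star t * cfc h a = cfc (fun x => star (φ x) * h x) a := by
  obtain ⟨t₀, -, ht₀, star_t₀⟩ := exists_mul_cfc_eq_cfc_mul norm_φ_le hh hφ hd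
  rwa [eq_of_mul_eq_of_denseRange hd (ht.trans ht₀.symm)]

theorem star_mul_self_mul_cfc_of_mul_cfc (hd : DenseRange (cfc h a).op)
    (hh : ContinuousOn h (spectrum ℂ a)) (hφ : ContinuousOn φ (spectrum ℂ a ∩ {x | h x ≠ 0}))
    (norm_φ_le : ∀ x ∈ spectrum ℂ a, ‖φ x‖ ≤ 1)
    (ht : t * cfc h a = cfc (fun x => φ x * h x) a) :
    star t * t * cfc h a = cfc (fun x => star (φ x) * (φ x * h x)) a := by
  have norm_star_φ_le : ∀ x ∈ spectrum ℂ a, ‖star (φ x)‖ ≤ 1 := by simpa using norm_φ_le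
  have hφh := continuousOn_mul_of_continuousOn_ne_zero hh norm_φ_le hφ
  rw [mul_assoc, ht]
  refine mul_cfc_of_mul_cfc hd hh ?_ hφh ?_ (star_mul_cfc_of_mul_cfc hd hh hφ norm_φ_le ht)
  · exact continuousOn_mul_of_continuousOn_ne_zero hh norm_star_φ_le hφ.star
  · refine continuousOn_mul_of_continuousOn_ne_zero hφh norm_star_φ_le (hφ.star.mono ?_)
    exact Set.inter_subset_inter_right _ fun x hx => right_ne_zero_of_mul hx

theorem isStarNormal_of_mul_cfc (hd : DenseRange (cfc h a).op)
    (hh : ContinuousOn h (spectrum ℂ a)) (hφ : ContinuousOn φ (spectrum ℂ a ∩ {x | h x ≠ 0}))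
    (norm_φ_le : ∀ x ∈ spectrum ℂ a, ‖φ x‖ ≤ 1)
    (ht : t * cfc h a = cfc (fun x => φ x * h x) a) : IsStarNormal t := by
  have norm_star_φ_le : ∀ x ∈ spectrum ℂ a, ‖star (φ x)‖ ≤ 1 := by simpa using norm_φ_le
  have ht_star := star_mul_cfc_of_mul_cfc hd hh hφ norm_φ_le ht
  have star_mul := star_mul_self_mul_cfc_of_mul_cfc hd hh hφ norm_φ_le ht
  have mul_star := star_mul_self_mul_cfc_of_mul_cfc hd hh hφ.star norm_star_φ_le ht_star
  refine ⟨eq_of_mul_eq_of_denseRange hd ?_⟩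
  rw [star_mul, ← star_star t, star_star (star t), mul_star]
  congr! 2 with x
  rw [star_star, mul_left_comm]

theorem denseRange_one_sub_star_mul_self (ha : IsStarNormal a) (hd : DenseRange (cfc h a).op)
    (hh : ContinuousOn h (spectrum ℂ a)) (hφ : ContinuousOn φ (spectrum ℂ a ∩ {x | h x ≠ 0}))
    (norm_φ_lt : ∀ x ∈ spectrum ℂ a, ‖φ x‖ < 1)
    (ht : t * cfc h a = cfc (fun x => φ x * h x) a) : DenseRange (1 - star t * t).op := by
  have norm_φ_le : ∀ x ∈ spectrum ℂ a, ‖φ x‖ ≤ 1 := fun x hx => (norm_φ_lt x hx).le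
  have norm_sq_le : ∀ x ∈ spectrum ℂ a, ‖star (φ x) * φ x‖ ≤ 1 := fun x hx => by
    rw [norm_mul, norm_star]
    exact mul_le_one₀ (norm_φ_le x hx) (norm_nonneg _) (norm_φ_le x hx)
  have continuousOn_sq : ContinuousOn (fun x => star (φ x) * (φ x * h x)) (spectrum ℂ a) :=
    (continuousOn_mul_of_continuousOn_ne_zero hh norm_sq_le (hφ.star.mul hφ)).congr
      fun x _ => (mul_assoc _ _ _).symm
  have mul_cfc_eq : (1 - star t * t) * cfc h a =
      cfc (fun x => h x - star (φ x) * (φ x * h x)) a := by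
    rw [sub_mul, one_mul, star_mul_self_mul_cfc_of_mul_cfc hd hh hφ norm_φ_le ht,
      ← cfc_sub _ _ a hh continuousOn_sq]
  have denseRange_mul_cfc : DenseRange ((1 - star t * t) * cfc h a).op := by
    rw [mul_cfc_eq]
    refine denseRange_cfc ha (hh.sub continuousOn_sq) hh (fun x hx h0 => ?_) hd
    have product_eq_zero : (1 - star (φ x) * φ x) * h x = 0 := by rw [← h0]; ring
    refine (mul_eq_zero.mp product_eq_zero).resolve_left fun eq_one => ?_
    have norm_sq : ‖φ x‖ * ‖φ x‖ = 1 := by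
      rw [← CStarRing.norm_star_mul_self, ← sub_eq_zero.mp eq_one, norm_one]
    nlinarith [norm_φ_lt x hx, norm_nonneg (φ x)]
  exact denseRange_mul_cfc.mono (Set.range_comp_subset_range _ (1 - star t * t).op)

end Values

section DiscCoordinates

/-- The function `√(1 - |ξ|²)` on the closed unit disc. Its value at the `z`-transform `z` of a
normal operator is `(1 - z⋆z)^{1/2}`; outside the disc it is `0`. -/
def discRoot (ξ : ℂ) : ℝ := √(1 - ‖ξ‖ ^ 2)

/-- The homeomorphism `c ↦ c / √(1 + |c|²)` of the plane onto the open unit disc, under which the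
spectrum of a normal operator corresponds to that of its `z`-transform. -/
def toDisc (c : ℂ) : ℂ := c / (√(1 + ‖c‖ ^ 2) : ℝ)

theorem continuous_discRoot : Continuous discRoot := by unfold discRoot; fun_prop

theorem discRoot_mul_self {ξ : ℂ} (h : ‖ξ‖ ≤ 1) : discRoot ξ * discRoot ξ = 1 - ‖ξ‖ ^ 2 :=
  Real.mul_self_sqrt (by nlinarith [norm_nonneg ξ])

theorem toDisc_eq_univUnitBall : toDisc = OpenPartialHomeomorph.univUnitBall := by
  funext c
  rw [OpenPartialHomeomorph.univUnitBall_apply, toDisc, Complex.real_smul, Complex.ofReal_inv,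
    inv_mul_eq_div]

theorem isOpenEmbedding_toDisc : IsOpenEmbedding toDisc :=
  toDisc_eq_univUnitBall ▸ OpenPartialHomeomorph.univUnitBall.isOpenEmbedding rfl

theorem range_toDisc : Set.range toDisc = Metric.ball 0 1 := by
  rw [toDisc_eq_univUnitBall, ← Set.image_univ]
  exact OpenPartialHomeomorph.univUnitBall.image_source_eq_target

theorem norm_toDisc_lt_one (c : ℂ) : ‖toDisc c‖ < 1 :=
  mem_ball_zero_iff.mp (range_toDisc ▸ Set.mem_range_self c)

theorem discRoot_toDisc (c : ℂ) : discRoot (toDisc c) = (√(1 + ‖c‖ ^ 2))⁻¹ := by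
  have norm_sq_toDisc : ‖toDisc c‖ ^ 2 = ‖c‖ ^ 2 / (1 + ‖c‖ ^ 2) := by
    rw [toDisc, norm_div, Complex.norm_real, div_pow, Real.norm_eq_abs, sq_abs,
      Real.sq_sqrt (by positivity)]
  rw [discRoot, norm_sq_toDisc, ← Real.sqrt_inv]
  congr 1
  field_simp
  ring

theorem toDisc_sub_mul_discRoot (c d : ℂ) :
    toDisc d - c * discRoot (toDisc d) = (d - c) * discRoot (toDisc d) := by
  rw [discRoot_toDisc, toDisc, Complex.ofReal_inv]
  ring

theorem discRoot_toDisc_ne_zero (c : ℂ) : (discRoot (toDisc c) : ℂ) ≠ 0 := by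
  rw [discRoot_toDisc]
  exact_mod_cast (by positivity : (√(1 + ‖c‖ ^ 2))⁻¹ ≠ 0)

theorem exists_toDisc_eq_of_discRoot_ne_zero {ξ : ℂ} (h : (discRoot ξ : ℂ) ≠ 0) :
    ∃ c, toDisc c = ξ := by
  have norm_lt : ‖ξ‖ < 1 := by
    contrapose! h
    rw [discRoot, Real.sqrt_eq_zero_of_nonpos (by nlinarith), Complex.ofReal_zero]
  exact range_toDisc.ge (mem_ball_zero_iff.mpr norm_lt)

theorem sub_mul_discRoot_eq_zero_iff {c ξ : ℂ} : ξ - c * discRoot ξ = 0 ↔ ξ = toDisc c := by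
  constructor
  · intro h
    obtain ⟨d, rfl⟩ : ∃ d, toDisc d = ξ := by
      refine exists_toDisc_eq_of_discRoot_ne_zero fun h0 => ?_
      obtain rfl : ξ = 0 := by simpa [h0] using h
      simp [discRoot] at h0
    rw [toDisc_sub_mul_discRoot] at h
    rw [sub_eq_zero.mp ((mul_eq_zero.mp h).resolve_right (discRoot_toDisc_ne_zero d))]
  · rintro rfl
    rw [toDisc_sub_mul_discRoot, sub_self, zero_mul]

/-- A function vanishing exactly outside the open unit disc and at the points `toDisc c` with
`c ∈ K`. The functional calculus off the exceptional set `K` is defined on the range of its value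
at the `z`-transform. -/
def vanishing (K : Finset ℂ) (ξ : ℂ) : ℂ := discRoot ξ * ∏ c ∈ K, (ξ - c * discRoot ξ)

theorem continuous_vanishing (K : Finset ℂ) : Continuous (vanishing K) := by
  have := continuous_discRoot
  unfold vanishing
  fun_prop

theorem vanishing_toDisc_ne_zero {K : Finset ℂ} {c : ℂ} (hc : c ∉ K) :
    vanishing K (toDisc c) ≠ 0 := by
  refine mul_ne_zero (discRoot_toDisc_ne_zero c) (Finset.prod_ne_zero_iff.mpr fun d hd => ?_)
  rw [sub_mul_discRoot_eq_zero_iff.ne]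
  exact fun h => hc (isOpenEmbedding_toDisc.injective h ▸ hd)

theorem exists_toDisc_eq_of_vanishing_ne_zero {K : Finset ℂ} {ξ : ℂ} (h : vanishing K ξ ≠ 0) :
    ∃ c ∉ K, toDisc c = ξ := by
  obtain ⟨c, rfl⟩ := exists_toDisc_eq_of_discRoot_ne_zero (left_ne_zero_of_mul h)
  refine ⟨c, fun hc => ?_, rfl⟩
  exact Finset.prod_ne_zero_iff.mp (right_ne_zero_of_mul h) c hc
    (sub_mul_discRoot_eq_zero_iff.mpr rfl)

end DiscCoordinates

section Extension

theorem norm_extend_zero_lt {X Y : Type*} {e : X → Y} {g : X → ℂ} {C : ℝ} (hC : 0 < C)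
    (hg : ∀ x, ‖g x‖ < C) (y : Y) : ‖Function.extend e g 0 y‖ < C := by
  by_cases hy : ∃ x, e x = y
  · classical
    rw [Function.extend_def, dif_pos hy]
    exact hg _
  · rwa [Function.extend_apply' _ _ _ hy, Pi.zero_apply, norm_zero]

variable {X Y : Type*} [TopologicalSpace X] [TopologicalSpace Y] {e : X → Y}

theorem continuousOn_extend_range (he : IsEmbedding e) {V : Type*} [TopologicalSpace V]
    {g : X → V} (hg : Continuous g) (j : Y → V) :
    ContinuousOn (Function.extend e g j) (Set.range e) := by
  rw [continuousOn_iff_continuous_domRestrict, ← he.toHomeomorph.comp_continuous_iff']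
  convert! hg using 1
  exact Function.extend_comp he.injective g j

theorem continuousOn_extend_zeroAtInfty [T2Space Y] (he : IsEmbedding e) (g : C₀(X, ℂ))
    {s U : Set Y} (hU : IsOpen U) (heU : ∀ x, e x ∈ U) (hsU : s ∩ U ⊆ Set.range e) :
    ContinuousOn (Function.extend e g 0) s := by
  intro y hy
  by_cases hyU : y ∈ U
  · exact (continuousWithinAt_inter (hU.mem_nhds hyU)).mp
      ((continuousOn_extend_range he (map_continuous g) 0).mono hsU y ⟨hy, hyU⟩)
  · have notMem_range : ¬ ∃ x, e x = y := by
      rintro ⟨x, rfl⟩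
      exact hyU (heU x)
    refine ContinuousAt.continuousWithinAt ?_
    rw [ContinuousAt, Function.extend_apply' _ _ _ notMem_range, Metric.tendsto_nhds]
    intro ε hε
    obtain ⟨C, hC, norm_lt⟩ := Filter.mem_cocompact.mp
      (Metric.tendsto_nhds.mp (zero_at_infty g) ε hε)
    have isClosed_image : IsClosed (e '' C) := (hC.image he.continuous).isClosed
    filter_upwards [isClosed_image.isOpen_compl.mem_nhds fun ⟨x, _, hx⟩ => notMem_range ⟨x, hx⟩]
      with w hw
    by_cases hwe : ∃ x, e x = w
    · obtain ⟨x, rfl⟩ := hwe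
      rw [he.injective.extend_apply]
      exact norm_lt fun hx => hw ⟨x, hx, rfl⟩
    · rwa [Function.extend_apply' _ _ _ hwe, Pi.zero_apply, Pi.zero_apply, dist_self]

end Extension

section DiscLift

variable {G : Set ℂ}

/-- A function on `G ⊆ ℂ` in the coordinate `ξ = toDisc c`, extended by zero. -/
def discLift (g : G → ℂ) : ℂ → ℂ := Function.extend (fun c : G => toDisc c) g 0

theorem isEmbedding_toDisc_coe : IsEmbedding fun c : G => toDisc c :=
  isOpenEmbedding_toDisc.isEmbedding.comp IsEmbedding.subtypeVal

theorem discLift_toDisc (g : G → ℂ) (c : G) : discLift g (toDisc c) = g c :=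
  isEmbedding_toDisc_coe.injective.extend_apply g 0 c

theorem discLift_of_forall_ne {g : G → ℂ} {ξ : ℂ} (h : ∀ c : G, toDisc c ≠ ξ) :
    discLift g ξ = 0 :=
  Function.extend_apply' _ _ _ (by simpa using h)

theorem discLift_zero : discLift (0 : G → ℂ) = 0 :=
  Function.extend_const _ 0

theorem discLift_add (g g' : G → ℂ) : discLift (g + g') = discLift g + discLift g' := by
  rw [discLift, discLift, discLift, ← Function.extend_add, add_zero]

theorem discLift_mul (g g' : G → ℂ) : discLift (g * g') = discLift g * discLift g' := by
  rw [discLift, discLift, discLift, ← Function.extend_mul, mul_zero]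

theorem discLift_smul (c : ℂ) (g : G → ℂ) : discLift (c • g) = c • discLift g := by
  rw [discLift, discLift, ← Function.extend_smul, smul_zero]

theorem discLift_star (g : G → ℂ) : discLift (star g) = star (discLift g) := by
  funext ξ
  rw [Pi.star_apply, discLift, discLift, Function.apply_extend star]
  congr 1
  exact funext fun _ => (star_zero ℂ).symm

theorem norm_discLift_zFun_lt_one (f : C(G, ℂ)) (ξ : ℂ) : ‖discLift (zFun f) ξ‖ < 1 :=
  norm_extend_zero_lt zero_lt_one (fun x => norm_toDisc_lt_one (f x)) ξ

end DiscLift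

section Spectrum

variable {A : Type*} [NonUnitalCStarAlgebra A] [PartialOrder A]
  {E : Type*} [NormedAddCommGroup E] [NormedSpace ℂ E] [SMul A E] [CStarModule A E]

theorem mem_graph_subScalar {T : E →ₗ.[ℂ] E} {c : ℂ} {x y : E} :
    (x, y) ∈ (subScalar T c).graph ↔ (x, y + c • x) ∈ T.graph := by
  rw [LinearPMap.mem_graph_iff, LinearPMap.mem_graph_iff]
  constructor
  · rintro ⟨u, rfl, rfl⟩
    exact ⟨⟨u, u.2.1⟩, rfl, (sub_add_cancel _ _).symm⟩
  · rintro ⟨u, rfl, hu⟩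
    exact ⟨⟨u, u.2, trivial⟩, rfl, sub_eq_iff_eq_add.mpr hu⟩

variable [StarOrderedRing A] [CompleteSpace E] {T : E →ₗ.[ℂ] E} {z q : Adj A E} {c : ℂ}

theorem norm_le_one_of_mem_spectrum (hz : ‖z‖ ≤ 1) {ξ : ℂ} (hξ : ξ ∈ spectrum ℂ z) : ‖ξ‖ ≤ 1 := by
  rcases subsingleton_or_nontrivial (Adj A E)
  · rw [spectrum.of_subsingleton] at hξ
    exact hξ.elim
  · exact (spectrum.norm_le_norm_of_mem hξ).trans hz

namespace IsZPair

theorem eq_cfc (h : IsZPair T z q) (hz : IsStarNormal z) :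
    q = cfc (fun ξ => (discRoot ξ : ℂ)) z := by
  have := continuous_discRoot
  have discRoot_nonneg : 0 ≤ cfc (fun ξ => (discRoot ξ : ℂ)) z :=
    cfc_nonneg fun ξ _ => Complex.zero_le_real.mpr (Real.sqrt_nonneg _)
  have one_sub_eq_cfc : 1 - star z * z = cfc (fun ξ : ℂ => 1 - star ξ * ξ) z := by
    rw [cfc_sub (fun _ : ℂ => 1) (fun ξ => star ξ * ξ) z,
      cfc_mul (fun ξ : ℂ => star ξ) (fun ξ => ξ) z, cfc_star (fun ξ : ℂ => ξ) z, cfc_id' ℂ z,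
      cfc_const_one ℂ z]
  rw [← CFC.mul_self_eq_mul_self_iff _ _ h.nonneg discRoot_nonneg, h.sq, one_sub_eq_cfc,
    ← cfc_mul _ _ z (by fun_prop) (by fun_prop)]
  refine cfc_congr fun ξ hξ => ?_
  rw [← Complex.ofReal_mul, discRoot_mul_self (norm_le_one_of_mem_spectrum h.norm_le hξ)]
  simp [Complex.conj_mul']

theorem sub_smul_eq_cfc (h : IsZPair T z q) (hz : IsStarNormal z) (c : ℂ) :
    z - c • q = cfc (fun ξ => ξ - c * discRoot ξ) z := by
  have := continuous_discRoot
  rw [cfc_sub (fun ξ => ξ) (fun ξ => c * discRoot ξ) z (by fun_prop) (by fun_prop),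
    cfc_const_mul c (fun ξ => (discRoot ξ : ℂ)) z (by fun_prop), cfc_id' ℂ z, ← h.eq_cfc hz]

theorem mem_graph_subScalar (h : IsZPair T z q) {x y : E} :
    (x, y) ∈ (subScalar T c).graph ↔ ∃ v, q.op v = x ∧ (z - c • q).op v = y := by
  rw [HilbertModule.mem_graph_subScalar, h.mem_graph_iff]
  refine exists_congr fun v => and_congr_right fun hv => ?_
  rw [Adj.sub_op, Adj.smul_op, hv, sub_eq_iff_eq_add]

theorem isUnit_of_isAdjointableInvertible (h : IsZPair T z q)
    (hc : IsAdjointableInvertible A (subScalar T c)) : IsUnit (z - c • q) := by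
  obtain ⟨R', ⟨s, hs⟩, le_one, eq_one⟩ := hc
  let R : Adj A E := Adj.mk hs
  have R_sub (v : E) : R.op ((z - c • q).op v) = q.op v := by
    have mem_graph : (q.op v, R.op ((z - c • q).op v)) ∈ (pcomp (toP R') (subScalar T c)).graph :=
      mem_graph_toP_pcomp.mpr ⟨_, h.mem_graph_subScalar.mpr ⟨v, rfl, rfl⟩, rfl⟩
    exact (mem_graph_toP.mp (LinearPMap.le_graph_of_le le_one mem_graph)).symm
  have surjective : Function.Surjective (z - c • q).op := fun y => by
    have mem_graph : (y, y) ∈ (pcomp (subScalar T c) (toP R')).graph := by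
      rw [eq_one, mem_graph_toP, ContinuousLinearMap.id_apply]
    obtain ⟨v, -, hv⟩ := h.mem_graph_subScalar.mp (mem_graph_pcomp_toP.mp mem_graph)
    exact ⟨v, hv⟩
  -- `1 = q * q + star z * z` and `z = (z - c • q) + c • q`, where `q = R * (z - c • q)`.
  let B : Adj A E := q * R + star z * (1 + c • R)
  have leftInverse (v : E) : B.op ((z - c • q).op v) = v := by
    rw [Adj.add_op, Adj.mul_op, Adj.mul_op, Adj.add_op, Adj.one_op, Adj.smul_op, R_sub,
      Adj.sub_op, Adj.smul_op, sub_add_cancel, h.add_eq]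
  refine isUnit_iff_exists.mpr ⟨B, Adj.ext fun y => ?_, Adj.ext fun v => ?_⟩
  · obtain ⟨v, rfl⟩ := surjective y
    rw [Adj.mul_op, leftInverse, Adj.one_op]
  · rw [Adj.mul_op, leftInverse, Adj.one_op]

theorem isAdjointableInvertible_of_isUnit (h : IsZPair T z q) (hc : IsUnit (z - c • q)) :
    IsAdjointableInvertible A (subScalar T c) := by
  obtain ⟨u, mul_eq_one, eq_one_mul⟩ := isUnit_iff_exists.mp hc
  refine ⟨(q * u).op, ⟨_, Adj.isAdjointPair_star _⟩, ?_, LinearPMap.eq_of_eq_graph ?_⟩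
  · rw [← LinearPMap.le_graph_iff]
    rintro ⟨x, y⟩ hxy
    obtain ⟨w, hw, rfl⟩ := mem_graph_toP_pcomp.mp hxy
    obtain ⟨v, rfl, rfl⟩ := h.mem_graph_subScalar.mp hw
    rw [mem_graph_toP, Adj.mul_op, ← Adj.mul_op u, eq_one_mul, Adj.one_op,
      ContinuousLinearMap.id_apply]
  · ext ⟨x, y⟩
    rw [mem_graph_pcomp_toP, mem_graph_toP, h.mem_graph_subScalar, ContinuousLinearMap.id_apply]
    constructor
    · rintro ⟨v, hv, rfl⟩
      rw [h.injective (hv.trans (Adj.mul_op q u x)), ← Adj.mul_op, mul_eq_one, Adj.one_op]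
    · rintro rfl
      exact ⟨u.op x, rfl, Adj.congr_op mul_eq_one x⟩

theorem mem_spec_iff (h : IsZPair T z q) (hz : IsStarNormal z) :
    c ∈ spec A T ↔ toDisc c ∈ spectrum ℂ z := by
  have := continuous_discRoot
  have isUnit_iff : IsAdjointableInvertible A (subScalar T c) ↔ IsUnit (z - c • q) :=
    ⟨h.isUnit_of_isAdjointableInvertible, h.isAdjointableInvertible_of_isUnit⟩
  rw [spec, Set.mem_ofPred_eq, isUnit_iff, h.sub_smul_eq_cfc hz,
    isUnit_cfc_iff (fun ξ => ξ - c * discRoot ξ) z (by fun_prop)]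
  simp only [ne_eq, sub_mul_discRoot_eq_zero_iff, not_forall, not_not, exists_prop,
    exists_eq_right]

theorem spectrum_inter_subset_range (h : IsZPair T z q) (hz : IsStarNormal z) (K : Finset ℂ) :
    spectrum ℂ z ∩ {ξ | vanishing K ξ ≠ 0} ⊆
      Set.range fun c : (spec A T \ K : Set ℂ) => toDisc c := by
  rintro ξ ⟨hξ, h0⟩
  obtain ⟨c, hcK, rfl⟩ := exists_toDisc_eq_of_vanishing_ne_zero h0
  exact ⟨⟨c, (h.mem_spec_iff hz).mpr hξ, hcK⟩, rfl⟩

theorem denseRange_of_isInvertible (h : IsZPair T z q) (hc : IsInvertible A (subScalar T c)) :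
    DenseRange (z - c • q).op := by
  have dense_domain := hc.2.dense_domain
  rw [LinearPMap.inverse_domain] at dense_domain
  refine dense_domain.mono ?_
  rintro _ ⟨x, rfl⟩
  obtain ⟨v, -, hv⟩ := h.mem_graph_subScalar.mp (LinearPMap.mem_graph (subScalar T c) x)
  exact ⟨v, hv⟩

theorem denseRange_of_notMem_spec (h : IsZPair T z q) (hc : c ∉ spec A T) :
    DenseRange (z - c • q).op := by
  obtain ⟨u, mul_eq_one, -⟩ :=
    isUnit_iff_exists.mp (h.isUnit_of_isAdjointableInvertible (not_not.mp hc))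
  exact Function.Surjective.denseRange fun v => ⟨u.op v, Adj.congr_op mul_eq_one v⟩

theorem denseRange_vanishing (h : IsZPair T z q) (hz : IsStarNormal z)
    (hd : DenseRange q.op) {K : Finset ℂ} (hK : ∀ c ∈ K, DenseRange (z - c • q).op) :
    DenseRange (cfc (vanishing K) z).op := by
  have := continuous_discRoot
  induction K using Finset.induction_on with
  | empty =>
    have vanishing_empty : vanishing ∅ = fun ξ => (discRoot ξ : ℂ) := by
      funext ξ
      rw [vanishing, Finset.prod_empty, mul_one]
    rwa [vanishing_empty, ← h.eq_cfc hz]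
  | insert c K hcK ih =>
    have vanishing_insert :
        vanishing (insert c K) = fun ξ => (ξ - c * discRoot ξ) * vanishing K ξ := by
      funext ξ
      rw [vanishing, vanishing, Finset.prod_insert hcK, mul_left_comm]
    rw [vanishing_insert,
      cfc_mul _ _ z (by fun_prop) (continuous_vanishing K).continuousOn, ← h.sub_smul_eq_cfc hz]
    exact denseRange_mul (hK c (Finset.mem_insert_self c K))
      (ih fun d hd => hK d (Finset.mem_insert_of_mem hd))

theorem continuousOn_discLift (h : IsZPair T z q) (hz : IsStarNormal z) {K : Finset ℂ}
    {G : Set ℂ} (hG : spec A T \ K ⊆ G) {g : G → ℂ} (hg : Continuous g) :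
    ContinuousOn (discLift g) (spectrum ℂ z ∩ {ξ | vanishing K ξ ≠ 0}) := by
  refine (continuousOn_extend_range isEmbedding_toDisc_coe hg 0).mono ?_
  refine (h.spectrum_inter_subset_range hz K).trans ?_
  rintro _ ⟨c, rfl⟩
  exact ⟨⟨c, hG c.2⟩, rfl⟩

theorem continuousOn_discLift_zFun_mul_vanishing (h : IsZPair T z q) (hz : IsStarNormal z)
    {K : Finset ℂ} {G : Set ℂ} (hG : spec A T \ K ⊆ G) (f : C(G, ℂ)) :
    ContinuousOn (fun ξ => discLift (zFun f) ξ * vanishing K ξ) (spectrum ℂ z) :=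
  continuousOn_mul_of_continuousOn_ne_zero (continuous_vanishing K).continuousOn
    (fun ξ _ => (norm_discLift_zFun_lt_one f ξ).le)
    (h.continuousOn_discLift hz hG (zFun f).continuous)

end IsZPair

end Spectrum

section Characterisation

variable {X : Type*} [TopologicalSpace X]

/-- The action of bounded continuous functions, the multipliers of `C₀(X)`, on `C₀(X)`. -/
def boundedMul (b : X →ᵇ ℂ) (g : C₀(X, ℂ)) : C₀(X, ℂ) where
  toFun x := b x * g x
  continuous_toFun := b.continuous.mul (map_continuous g)
  zero_at_infty' := by
    refine squeeze_zero_norm (a := fun x => ‖b‖ * ‖g x‖) (fun x => ?_) ?_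
    · grw [norm_mul, b.norm_coe_le_norm x]
    · simpa using (zero_at_infty g).norm.const_mul ‖b‖

theorem norm_boundedMul_le (b : X →ᵇ ℂ) (g : C₀(X, ℂ)) : ‖boundedMul b g‖ ≤ ‖g‖ * ‖b‖ := by
  rw [← ZeroAtInftyContinuousMap.norm_toBCF_eq_norm, ← ZeroAtInftyContinuousMap.norm_toBCF_eq_norm,
    mul_comm]
  exact norm_mul_le b g.toBCF

theorem continuous_boundedMul (g : C₀(X, ℂ)) : Continuous fun b => boundedMul b g := by
  let L : (X →ᵇ ℂ) →ₗ[ℂ] C₀(X, ℂ) :=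
    { toFun := fun b => boundedMul b g
      map_add' := fun b b' => by ext x; exact add_mul (b x) (b' x) (g x)
      map_smul' := fun c b => by ext x; exact smul_mul_assoc c (b x) (g x) }
  exact (L.mkContinuous ‖g‖ fun b => norm_boundedMul_le b g).continuous

variable {A : Type*} [NonUnitalCStarAlgebra A] [PartialOrder A] [StarOrderedRing A]
  {E : Type*} [NormedAddCommGroup E] [NormedSpace ℂ E] [SMul A E] [CStarModule A E]
  [CompleteSpace E]

namespace IsNondegenerateStarHom

variable {π : C₀(X, ℂ) →ₙₐ[ℂ] (E →L[ℂ] E)}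

/-- A `⋆`-homomorphism into `𝓛(E)`, with values in the C⋆-algebra `Adj A E`. -/
def toAdj (hπ : IsNondegenerateStarHom A π) : C₀(X, ℂ) →⋆ₙₐ[ℂ] Adj A E where
  toFun g := Adj.mk (hπ.adjoint g)
  map_smul' c g := Adj.ext fun v => DFunLike.congr_fun (map_smul π c g) v
  map_zero' := Adj.ext fun v => DFunLike.congr_fun (map_zero π) v
  map_add' g g' := Adj.ext fun v => DFunLike.congr_fun (map_add π g g') v
  map_mul' g g' := Adj.ext fun v => DFunLike.congr_fun (map_mul π g g') v
  map_star' g := Adj.ext fun v =>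
    (DFunLike.congr_fun (Adj.op_star_eq (t := Adj.mk (hπ.adjoint g)) (hπ.adjoint g)) v).symm

theorem continuous_toAdj (hπ : IsNondegenerateStarHom A π) : Continuous hπ.toAdj :=
  AddMonoidHomClass.continuous_of_bound hπ.toAdj 1 fun g =>
    (NonUnitalStarAlgHom.norm_apply_le hπ.toAdj g).trans_eq (one_mul _).symm

theorem eq_of_mul_eq (hπ : IsNondegenerateStarHom A π) {a b : Adj A E}
    (h : ∀ g, a * hπ.toAdj g = b * hπ.toAdj g) : a = b := by
  refine Adj.ext <| congrFun <|
    Continuous.ext_on hπ.nondegenerate a.op.continuous b.op.continuous ?_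
  refine LinearMap.eqOn_span' (f := a.op.toLinearMap) (g := b.op.toLinearMap) ?_
  rintro _ ⟨g, v, rfl⟩
  exact Adj.congr_op (h g) v

theorem star_mul_eq (hπ : IsNondegenerateStarHom A π) {a : Adj A E} {b : X →ᵇ ℂ}
    (h : ∀ g, a * hπ.toAdj g = hπ.toAdj (boundedMul b g)) (g : C₀(X, ℂ)) :
    star a * hπ.toAdj g = hπ.toAdj (boundedMul (star b) g) := by
  refine star_injective (hπ.eq_of_mul_eq fun g' => ?_)
  rw [star_mul, star_star, mul_assoc, h g', ← map_star, ← map_star, ← map_mul, ← map_mul]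
  congr 1
  ext x
  change star (g x) * (b x * g' x) = star (star (b x) * g x) * g' x
  rw [star_mul, star_star, mul_assoc]

theorem cfcHom_mul_eq (hπ : IsNondegenerateStarHom A π) {z : Adj A E} (hz : IsStarNormal z)
    {j : C(X, spectrum ℂ z)}
    (h : ∀ g g' : C₀(X, ℂ), (∀ x, g' x = j x * g x) → z * hπ.toAdj g = hπ.toAdj g')
    (u : C(spectrum ℂ z, ℂ)) (g : C₀(X, ℂ)) :
    cfcHom hz u * hπ.toAdj g =
      hπ.toAdj (boundedMul ((BoundedContinuousFunction.mkOfCompact u).compContinuous j) g) := by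
  have mul_id (g : C₀(X, ℂ)) : cfcHom hz (.restrict _ (.id ℂ)) * hπ.toAdj g = hπ.toAdj
      (boundedMul ((BoundedContinuousFunction.mkOfCompact
        (.restrict (spectrum ℂ z) (.id ℂ))).compContinuous j) g) := by
    rw [cfcHom_id hz]
    exact h g _ fun x => rfl
  induction u using ContinuousMap.induction_on_of_compact generalizing g with
  | const c =>
    have const_eq : ContinuousMap.const (spectrum ℂ z) c = algebraMap ℂ _ c := rfl
    rw [const_eq, AlgHomClass.commutes, Algebra.algebraMap_eq_smul_one, smul_one_mul, ← map_smul]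
    rfl
  | id => exact mul_id g
  | star_id =>
    rw [map_star]
    exact hπ.star_mul_eq mul_id g
  | add u u' hu hu' =>
    rw [map_add, add_mul, hu, hu', ← map_add]
    congr 1
    ext x
    exact (add_mul _ _ _).symm
  | mul u u' hu hu' =>
    rw [map_mul, mul_assoc, hu', hu]
    congr 1
    ext x
    exact (mul_assoc _ _ _).symm
  | frequently u hu =>
    refine (hu.mono fun v hv => hv g).mem_of_closed (isClosed_eq ?_ ?_)
    · exact (cfcHom_continuous hz).mul continuous_const
    · exact hπ.continuous_toAdj.comp <| (continuous_boundedMul g).comp <|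
        (BoundedContinuousFunction.continuous_compContinuous j).comp
          (ContinuousMap.isometryEquivBoundedOfCompact _ ℂ).continuous

theorem cfc_mul_eq (hπ : IsNondegenerateStarHom A π) {z : Adj A E} (hz : IsStarNormal z)
    {j : C(X, spectrum ℂ z)}
    (h : ∀ g g' : C₀(X, ℂ), (∀ x, g' x = j x * g x) → z * hπ.toAdj g = hπ.toAdj g')
    {φ : ℂ → ℂ} (hφ : ContinuousOn φ (spectrum ℂ z)) {g g' : C₀(X, ℂ)}
    (hg : ∀ x, g' x = φ (j x) * g x) : cfc φ z * hπ.toAdj g = hπ.toAdj g' := by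
  rw [cfc_apply φ z hz hφ, hπ.cfcHom_mul_eq hz h]
  congr 1
  ext x
  exact (hg x).symm

end IsNondegenerateStarHom

end Characterisation

section FunctionOf

variable {A : Type*} [NonUnitalCStarAlgebra A] [PartialOrder A] [StarOrderedRing A]
  {E : Type*} [NormedAddCommGroup E] [NormedSpace ℂ E] [SMul A E] [CStarModule A E]
  [CompleteSpace E] {T R : E →ₗ.[ℂ] E} {z q : Adj A E}

/-- The map `c ↦ toDisc c` from the spectrum of a normal operator to the spectrum of its
`z`-transform. -/
def IsZPair.toSpectrum (h : IsZPair T z q) (hz : IsStarNormal z) (K : Set ℂ) :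
    C((spec A T \ K : Set ℂ), spectrum ℂ z) where
  toFun c := ⟨toDisc c, (h.mem_spec_iff hz).mp c.2.1⟩
  continuous_toFun := isEmbedding_toDisc_coe.continuous.subtype_mk _

theorem IsFunctionOf.exists_isZPair (h : IsZPair T z q) (hz : IsStarNormal z) {G : Set ℂ}
    {f : C(G, ℂ)} (hR : IsFunctionOf A T f R) :
    ∃ (K : Finset ℂ) (t r : Adj A E), (∀ c ∈ K, IsInvertible A (subScalar T c)) ∧
      spec A T \ K ⊆ G ∧ IsZPair R t r ∧
      t * cfc (vanishing K) z = cfc (fun ξ => discLift (zFun f) ξ * vanishing K ξ) z := by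
  obtain ⟨K, hK, hinv, hG, π, hπ, ⟨-, z', hz', hπz⟩, -, t', ht', hπt⟩ := hR
  lift K to Finset ℂ using hK
  obtain ⟨z', q', rfl, h'⟩ := IsZPair.of_isZTransform hz'
  obtain rfl := h.unique h'
  obtain ⟨t, r, rfl, ht⟩ := IsZPair.of_isZTransform ht'
  refine ⟨K, t, r, hinv, hG, ht, hπ.eq_of_mul_eq fun g => ?_⟩
  let j := h.toSpectrum hz (K : Set ℂ)
  have mul_toAdj (g g' : C₀((spec A T \ K : Set ℂ), ℂ)) (hg : ∀ c, g' c = j c * g c) :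
      z' * hπ.toAdj g = hπ.toAdj g' := by
    have g'_eq : g' = zMul ⟨Subtype.val, continuous_subtype_val⟩ g :=
      ZeroAtInftyContinuousMap.ext hg
    exact Adj.ext fun v => g'_eq ▸ hπz g v
  let g₁ := boundedMul ((BoundedContinuousFunction.mkOfCompact
    ⟨fun ξ : spectrum ℂ z' => vanishing K ξ, by have := continuous_vanishing K; fun_prop⟩
    ).compContinuous j) g
  have vanishing_mul : cfc (vanishing K) z' * hπ.toAdj g = hπ.toAdj g₁ :=
    hπ.cfc_mul_eq hz mul_toAdj (continuous_vanishing K).continuousOn fun _ => rfl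
  have t_mul : t * hπ.toAdj g₁ =
      hπ.toAdj (zMul (f.comp ⟨Set.inclusion hG, continuous_inclusion hG⟩) g₁) :=
    Adj.ext fun v => hπt _ v
  rw [mul_assoc, vanishing_mul, t_mul]
  refine (hπ.cfc_mul_eq hz mul_toAdj
    (h.continuousOn_discLift_zFun_mul_vanishing hz hG f) fun c => ?_).symm
  change _ = discLift (zFun f) (toDisc c) * _ * _
  rw [discLift_toDisc (zFun f) ⟨c, hG c.2⟩, mul_assoc]
  rfl

end FunctionOf

section Existence

variable {A : Type*} [NonUnitalCStarAlgebra A] [PartialOrder A] [StarOrderedRing A]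
  {E : Type*} [NormedAddCommGroup E] [NormedSpace ℂ E] [SMul A E] [CStarModule A E]
  [CompleteSpace E] {T : E →ₗ.[ℂ] E} {z q t : Adj A E} {K : Finset ℂ}

namespace IsZPair

theorem continuousOn_discLift_zeroAtInfty (h : IsZPair T z q) (hz : IsStarNormal z)
    (g : C₀((spec A T \ K : Set ℂ), ℂ)) : ContinuousOn (discLift g) (spectrum ℂ z) :=
  continuousOn_extend_zeroAtInfty isEmbedding_toDisc_coe g
    (isOpen_ne_fun (continuous_vanishing K) continuous_const)
    (fun c => vanishing_toDisc_ne_zero c.2.2) (h.spectrum_inter_subset_range hz K)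

/-- The representation of `C₀(σ(T) \ K)` given by the functional calculus of the `z`-transform. -/
def rep (h : IsZPair T z q) (hz : IsStarNormal z) (K : Finset ℂ) :
    C₀((spec A T \ K : Set ℂ), ℂ) →ₙₐ[ℂ] (E →L[ℂ] E) where
  toFun g := (cfc (discLift g) z).op
  map_smul' c g := by
    rw [ZeroAtInftyContinuousMap.coe_smul, discLift_smul]
    exact congrArg Adj.op (cfc_smul c _ z (h.continuousOn_discLift_zeroAtInfty hz g))
  map_zero' := by
    rw [ZeroAtInftyContinuousMap.coe_zero, discLift_zero, cfc_zero]
    rfl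
  map_add' g g' := by
    rw [ZeroAtInftyContinuousMap.coe_add, discLift_add]
    exact congrArg Adj.op (cfc_add z _ _ (h.continuousOn_discLift_zeroAtInfty hz g)
      (h.continuousOn_discLift_zeroAtInfty hz g'))
  map_mul' g g' := by
    rw [ZeroAtInftyContinuousMap.coe_mul, discLift_mul]
    exact congrArg Adj.op (cfc_mul _ _ z (h.continuousOn_discLift_zeroAtInfty hz g)
      (h.continuousOn_discLift_zeroAtInfty hz g'))

theorem rep_apply (h : IsZPair T z q) (hz : IsStarNormal z)
    (g : C₀((spec A T \ K : Set ℂ), ℂ)) : h.rep hz K g = (cfc (discLift g) z).op := rfl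

theorem isCompact_setOf_le_norm_vanishing (h : IsZPair T z q) (hz : IsStarNormal z)
    (K : Finset ℂ) {ε : ℝ} (hε : 0 < ε) :
    IsCompact {c : (spec A T \ K : Set ℂ) | ε ≤ ‖vanishing K (toDisc c)‖} := by
  have subset_range : spectrum ℂ z ∩ {ξ | ε ≤ ‖vanishing K ξ‖} ⊆
      Set.range fun c : (spec A T \ K : Set ℂ) => toDisc c :=
    (Set.inter_subset_inter_right _ fun ξ hξ => norm_pos_iff.mp (hε.trans_le hξ)).trans
      (h.spectrum_inter_subset_range hz K)
  convert! (isEmbedding_toDisc_coe.isInducing.isCompact_preimage_iff subset_range).mpr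
    ((spectrum.isCompact z).inter_right
      (isClosed_le continuous_const (continuous_vanishing K).norm)) using 1
  ext c
  exact (and_iff_right ((h.mem_spec_iff hz).mp c.2.1)).symm

/-- The function `vanishing K`, as an element of `C₀(σ(T) \ K)`. -/
def vanishingZeroAtInfty (h : IsZPair T z q) (hz : IsStarNormal z) (K : Finset ℂ) :
    C₀((spec A T \ K : Set ℂ), ℂ) where
  toFun c := vanishing K (toDisc c)
  continuous_toFun := (continuous_vanishing K).comp isEmbedding_toDisc_coe.continuous
  zero_at_infty' := by
    refine Metric.tendsto_nhds.mpr fun ε hε => Filter.mem_cocompact.mpr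
      ⟨_, h.isCompact_setOf_le_norm_vanishing hz K hε, fun c hc => ?_⟩
    rw [Set.mem_ofPred_eq, dist_zero_right]
    exact not_le.mp hc

theorem cfc_discLift_vanishingZeroAtInfty (h : IsZPair T z q) (hz : IsStarNormal z)
    (K : Finset ℂ) :
    cfc (discLift (h.vanishingZeroAtInfty hz K)) z = cfc (vanishing K) z := by
  refine cfc_congr fun ξ hξ => ?_
  by_cases h0 : vanishing K ξ = 0
  · rw [h0, discLift_of_forall_ne]
    rintro c rfl
    exact vanishing_toDisc_ne_zero c.2.2 h0
  · obtain ⟨c, rfl⟩ := h.spectrum_inter_subset_range hz K ⟨hξ, h0⟩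
    exact discLift_toDisc _ c

theorem isNondegenerateStarHom_rep (h : IsZPair T z q) (hz : IsStarNormal z)
    (hd : DenseRange (cfc (vanishing K) z).op) : IsNondegenerateStarHom A (h.rep hz K) where
  adjoint g := by
    have cfc_star_eq : cfc (discLift ⇑(star g)) z = star (cfc (discLift g) z) := by
      rw [← cfc_star, ZeroAtInftyContinuousMap.coe_star, discLift_star]
      rfl
    rw [h.rep_apply, h.rep_apply, cfc_star_eq]
    exact Adj.isAdjointPair_star _
  nondegenerate := by
    refine hd.mono ?_
    rintro _ ⟨v, rfl⟩
    refine Submodule.subset_span ⟨h.vanishingZeroAtInfty hz K, v, ?_⟩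
    rw [h.rep_apply, cfc_discLift_vanishingZeroAtInfty]

theorem mul_cfc_discLift (h : IsZPair T z q) (hz : IsStarNormal z)
    (g : C₀((spec A T \ K : Set ℂ), ℂ)) :
    z * cfc (discLift g) z =
      cfc (discLift (zMul ⟨Subtype.val, continuous_subtype_val⟩ g)) z := by
  nth_rewrite 1 [← cfc_id' ℂ z]
  rw [← cfc_mul _ _ z (by fun_prop) (h.continuousOn_discLift_zeroAtInfty hz g)]
  refine cfc_congr fun ξ _ => ?_
  by_cases hξ : ∃ c : (spec A T \ K : Set ℂ), toDisc c = ξ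
  · obtain ⟨c, rfl⟩ := hξ
    rw [discLift_toDisc, discLift_toDisc]
    rfl
  · rw [discLift_of_forall_ne (not_exists.mp hξ), discLift_of_forall_ne (not_exists.mp hξ),
      mul_zero]

theorem mul_cfc_discLift_of_mul_cfc_vanishing (h : IsZPair T z q) (hz : IsStarNormal z)
    (hd : DenseRange (cfc (vanishing K) z).op) {G : Set ℂ} (hG : spec A T \ K ⊆ G) {f : C(G, ℂ)}
    (ht : t * cfc (vanishing K) z = cfc (fun ξ => discLift (zFun f) ξ * vanishing K ξ) z)
    (g : C₀((spec A T \ K : Set ℂ), ℂ)) :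
    t * cfc (discLift g) z =
      cfc (discLift (zMul (f.comp ⟨Set.inclusion hG, continuous_inclusion hG⟩) g)) z := by
  have discLift_zMul : (fun ξ => discLift (zFun f) ξ * discLift g ξ) =
      discLift (zMul (f.comp ⟨Set.inclusion hG, continuous_inclusion hG⟩) g) := by
    funext ξ
    by_cases hξ : ∃ c : (spec A T \ K : Set ℂ), toDisc c = ξ
    · obtain ⟨c, rfl⟩ := hξ
      rw [discLift_toDisc g, discLift_toDisc (zMul _ g), discLift_toDisc (zFun f) ⟨c, hG c.2⟩]
      rfl
    · rw [discLift_of_forall_ne (not_exists.mp hξ), discLift_of_forall_ne (not_exists.mp hξ),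
        mul_zero]
  rw [← discLift_zMul]
  refine mul_cfc_of_mul_cfc hd (continuous_vanishing K).continuousOn
    (h.continuousOn_discLift_zFun_mul_vanishing hz hG f)
    (h.continuousOn_discLift_zeroAtInfty hz g) ?_ ht
  rw [discLift_zMul]
  exact h.continuousOn_discLift_zeroAtInfty hz _

end IsZPair

variable (A T) in
/-- `G` contains `σ(T)` up to finitely many points `c` such that `T - c 1` is invertible. Unlike in
`IsCompatible`, the set `G` need not be almost closed. -/
def IsWeaklyCompatible (G : Set ℂ) : Prop :=
  ∃ K : Set ℂ, K.Finite ∧ (∀ c ∈ K, IsInvertible A (subScalar T c)) ∧ spec A T \ K ⊆ G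

theorem IsNormal.exists_isFunctionOf (hT : IsNormal A T) {G : Set ℂ}
    (hG : IsWeaklyCompatible A T G) (f : C(G, ℂ)) : ∃ R : E →ₗ.[ℂ] E, IsFunctionOf A T f R := by
  obtain ⟨z, q, h, hz, hdq⟩ := hT.exists_isZPair
  obtain ⟨K, hK, hinv, hsub⟩ := hG
  lift K to Finset ℂ using hK
  have hd := h.denseRange_vanishing hz hdq fun c hc => h.denseRange_of_isInvertible (hinv c hc)
  have hv := (continuous_vanishing K).continuousOn (s := spectrum ℂ z)
  have hφ := h.continuousOn_discLift hz hsub (zFun f).continuous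
  have norm_lt (ξ : ℂ) (_ : ξ ∈ spectrum ℂ z) := norm_discLift_zFun_lt_one f ξ
  have norm_le (ξ : ℂ) (_ : ξ ∈ spectrum ℂ z) := (norm_discLift_zFun_lt_one f ξ).le
  obtain ⟨t, norm_t, ht, -⟩ := exists_mul_cfc_eq_cfc_mul norm_le hv hφ hd
  obtain ⟨R, r, hR, hdr⟩ :=
    HilbertModule.exists_isZPair norm_t (denseRange_one_sub_star_mul_self hz hd hv hφ norm_lt ht)
  have ht_normal := isStarNormal_of_mul_cfc hd hv hφ norm_le ht
  exact ⟨R, K, K.finite_toSet, hinv, hsub, h.rep hz K, h.isNondegenerateStarHom_rep hz hd,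
    ⟨hT.regular, z.op, h.isZTransform, fun g v => Adj.congr_op (h.mul_cfc_discLift hz g) v⟩,
    ⟨hR.isRegular ht_normal hdr, t.op, hR.isZTransform, fun g v =>
      Adj.congr_op (h.mul_cfc_discLift_of_mul_cfc_vanishing hz hd hsub ht g) v⟩⟩

end Existence

section Intertwining

variable {A : Type*} [NonUnitalCStarAlgebra A] [PartialOrder A] {E F : Type*}
  [NormedAddCommGroup E] [NormedSpace ℂ E] [SMul A E] [CStarModule A E]
  [NormedAddCommGroup F] [NormedSpace ℂ F] [SMul A F] [CStarModule A F]
  {U : E →L[ℂ] F} {a b : Adj A E} {a' b' : Adj A F}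

theorem Intertwines.mul (ha : Intertwines U a a') (hb : Intertwines U b b') :
    Intertwines U (a * b) (a' * b') :=
  fun x => by rw [Adj.mul_op, Adj.mul_op, ha, hb]

theorem Intertwines.of_mul_right (hd : DenseRange b.op) (hb : Intertwines U b b')
    (h : Intertwines U (a * b) (a' * b')) : Intertwines U a a' := by
  refine fun x => hd.induction_on (p := fun x => U (a.op x) = a'.op (U x)) x
    (isClosed_eq (by fun_prop) (by fun_prop)) fun w => ?_
  rw [hb, ← Adj.mul_op, ← Adj.mul_op, h]

theorem IsUnitary.bijective (hU : IsUnitary A U) : Function.Bijective U := by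
  obtain ⟨V, -, comp_eq, comp_eq'⟩ := hU
  exact Function.bijective_iff_has_inverse.mpr
    ⟨V, DFunLike.congr_fun comp_eq, DFunLike.congr_fun comp_eq'⟩

variable [StarOrderedRing A] [CompleteSpace E] [CompleteSpace F]

section IsZPair

variable {S : E →ₗ.[ℂ] E} {T : F →ₗ.[ℂ] F} {t r : Adj A E} {t' r' : Adj A F}

theorem pcomp_le_of_intertwines (hS : IsZPair S t r) (hT : IsZPair T t' r')
    (ht : Intertwines U t t') (hr : Intertwines U r r') :
    pcomp (toP U) S ≤ pcomp T (toP U) := by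
  refine pcomp_toP_le_iff.mpr fun x y hxy => ?_
  obtain ⟨v, rfl, rfl⟩ := (hS.mem_graph_iff _ _).mp hxy
  exact (hT.mem_graph_iff _ _).mpr ⟨U v, (hr v).symm, (ht v).symm⟩

theorem pcomp_eq_of_intertwines (hS : IsZPair S t r) (hT : IsZPair T t' r')
    (ht : Intertwines U t t') (hr : Intertwines U r r') (hU : Function.Bijective U) :
    pcomp (toP U) S = pcomp T (toP U) := by
  refine LinearPMap.eq_of_eq_graph (le_antisymm
    (LinearPMap.le_graph_of_le (pcomp_le_of_intertwines hS hT ht hr)) ?_)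
  rintro ⟨x, y⟩ hxy
  obtain ⟨w, hw, rfl⟩ := (hT.mem_graph_iff _ _).mp (mem_graph_pcomp_toP.mp hxy)
  obtain ⟨v, rfl⟩ := hU.surjective w
  rw [← hr] at hw
  exact mem_graph_toP_pcomp.mpr
    ⟨_, (hS.mem_graph_iff _ _).mpr ⟨v, hU.injective hw, rfl⟩, ht v⟩

theorem IsZPair.intertwines_sqrt (hS : IsZPair S t r) (hT : IsZPair T t' r')
    (ht : IsStarNormal t) (ht' : IsStarNormal t') (h : Intertwines U t t') :
    Intertwines U r r' :=
  .of_mul_self hS.nonneg hT.nonneg fun x => by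
    rw [hS.sq, hT.sq, Adj.sub_op, Adj.sub_op, map_sub, Adj.one_op, Adj.one_op,
      (h.star ht ht').mul h]

end IsZPair

theorem sdiff_filter_notMem_subset {α : Type*} {Y G : Set α} {M N : Finset α}
    [DecidablePred (· ∉ G)] (hMN : M ⊆ N) (hY : Y \ M ⊆ G) : Y \ N.filter (· ∉ G) ⊆ G := by
  intro c hc
  by_contra hcG
  have hcM : c ∉ M := fun hcM => hc.2 (Finset.mem_filter.mpr ⟨hMN hcM, hcG⟩)
  exact hcG (hY ⟨hc.1, hcM⟩)

variable {S : E →ₗ.[ℂ] E} {T : F →ₗ.[ℂ] F} {z q t : Adj A E} {z' q' t' : Adj A F}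
  {K L : Finset ℂ} {G : Set ℂ} {f : C(G, ℂ)}

theorem IsZPair.denseRange_vanishing_of_disjoint (h : IsZPair S z q) (hz : IsStarNormal z)
    (hd : DenseRange q.op) (hK : ∀ c ∈ K, IsInvertible A (subScalar S c))
    (hG : spec A S \ K ⊆ G) (hL : ∀ c ∈ L, c ∉ G) : DenseRange (cfc (vanishing L) z).op := by
  refine h.denseRange_vanishing hz hd fun c hc => ?_
  by_cases hcK : c ∈ K
  · exact h.denseRange_of_isInvertible (hK c hcK)
  · exact h.denseRange_of_notMem_spec fun hs => hL c hc (hG ⟨hs, hcK⟩)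

theorem IsZPair.mul_cfc_vanishing (h : IsZPair S z q) (hz : IsStarNormal z)
    (hK : spec A S \ K ⊆ G) (hL : spec A S \ L ⊆ G)
    (hd : DenseRange (cfc (vanishing K) z).op)
    (ht : t * cfc (vanishing K) z = cfc (fun ξ => discLift (zFun f) ξ * vanishing K ξ) z) :
    t * cfc (vanishing L) z = cfc (fun ξ => discLift (zFun f) ξ * vanishing L ξ) z :=
  mul_cfc_of_mul_cfc hd (continuous_vanishing K).continuousOn
    (h.continuousOn_discLift_zFun_mul_vanishing hz hK f)
    (continuous_vanishing L).continuousOn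
    (h.continuousOn_discLift_zFun_mul_vanishing hz hL f) ht

theorem IsZPair.isStarNormal_of_mul_cfc_vanishing (h : IsZPair S z q) (hz : IsStarNormal z)
    (hG : spec A S \ K ⊆ G) (hd : DenseRange (cfc (vanishing K) z).op)
    (ht : t * cfc (vanishing K) z = cfc (fun ξ => discLift (zFun f) ξ * vanishing K ξ) z) :
    IsStarNormal t :=
  isStarNormal_of_mul_cfc hd (continuous_vanishing K).continuousOn
    (h.continuousOn_discLift hz hG (zFun f).continuous)
    (fun ξ _ => (norm_discLift_zFun_lt_one f ξ).le) ht

theorem IsZPair.intertwines_of_mul_cfc_vanishing (h : IsZPair S z q) (h' : IsZPair T z' q')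
    (hz : IsStarNormal z) (hz' : IsStarNormal z') (hU : Intertwines U z z')
    (hU_star : Intertwines U (star z) (star z')) (hG : spec A S \ K ⊆ G) (hG' : spec A T \ K ⊆ G)
    (hd : DenseRange (cfc (vanishing K) z).op)
    (ht : t * cfc (vanishing K) z = cfc (fun ξ => discLift (zFun f) ξ * vanishing K ξ) z)
    (ht' : t' * cfc (vanishing K) z' = cfc (fun ξ => discLift (zFun f) ξ * vanishing K ξ) z') :
    Intertwines U t t' := by
  have intertwines_vanishing : Intertwines U (cfc (vanishing K) z) (cfc (vanishing K) z') :=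
    hU.cfc hz hz' hU_star (continuous_vanishing K).continuousOn
  refine .of_mul_right hd intertwines_vanishing ?_
  rw [ht, ht']
  exact hU.cfc hz hz' hU_star <|
    (h.continuousOn_discLift_zFun_mul_vanishing hz hG f).union_of_isClosed
      (h'.continuousOn_discLift_zFun_mul_vanishing hz' hG' f)
      (spectrum.isClosed z) (spectrum.isClosed z')

/-- The exceptional sets `K` and `K'` of `S` and `T` may differ; both values can be computed with
the common set of the points of `K ∪ K'` outside `G`. -/
theorem exists_intertwines_of_isFunctionOf {fS : E →ₗ.[ℂ] E} {fT : F →ₗ.[ℂ] F}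
    (hS : IsNormal A S) (hT : IsNormal A T) (hU : pcomp (toP U) S ≤ pcomp T (toP U))
    (hfS : IsFunctionOf A S f fS) (hfT : IsFunctionOf A T f fT) :
    ∃ (t r : Adj A E) (t' r' : Adj A F), IsZPair fS t r ∧ IsZPair fT t' r' ∧
      Intertwines U t t' ∧ Intertwines U r r' := by
  classical
  obtain ⟨z, q, h, hz, hd⟩ := hS.exists_isZPair
  obtain ⟨z', q', h', hz', hd'⟩ := hT.exists_isZPair
  obtain ⟨-, intertwines_z, intertwines_star⟩ := h.intertwines_of_pcomp_le h' hz hz' hd hU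
  obtain ⟨K, t, r, hK, hKG, hfS_pair, ht⟩ := hfS.exists_isZPair h hz
  obtain ⟨K', t', r', hK', hKG', hfT_pair, ht'⟩ := hfT.exists_isZPair h' hz'
  have hdK := h.denseRange_vanishing hz hd fun c hc => h.denseRange_of_isInvertible (hK c hc)
  have hdK' := h'.denseRange_vanishing hz' hd' fun c hc =>
    h'.denseRange_of_isInvertible (hK' c hc)
  let L := (K ∪ K').filter (· ∉ G)
  have hLS : spec A S \ L ⊆ G := sdiff_filter_notMem_subset Finset.subset_union_left hKG
  have hLT : spec A T \ L ⊆ G := sdiff_filter_notMem_subset Finset.subset_union_right hKG'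
  have hdL : DenseRange (cfc (vanishing L) z).op :=
    h.denseRange_vanishing_of_disjoint hz hd hK hKG fun c hc => (Finset.mem_filter.mp hc).2
  have intertwines_t : Intertwines U t t' :=
    h.intertwines_of_mul_cfc_vanishing h' hz hz' intertwines_z intertwines_star hLS hLT hdL
      (h.mul_cfc_vanishing hz hKG hLS hdK ht) (h'.mul_cfc_vanishing hz' hKG' hLT hdK' ht')
  have ht_normal := h.isStarNormal_of_mul_cfc_vanishing hz hKG hdK ht
  have ht'_normal := h'.isStarNormal_of_mul_cfc_vanishing hz' hKG' hdK' ht'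
  exact ⟨t, r, t', r', hfS_pair, hfT_pair, intertwines_t,
    hfS_pair.intertwines_sqrt hfT_pair ht_normal ht'_normal intertwines_t⟩

theorem IsFunctionOf.unique {R R' : E →ₗ.[ℂ] E} (hS : IsNormal A S) (h : IsFunctionOf A S f R)
    (h' : IsFunctionOf A S f R') : R = R' := by
  obtain ⟨t, r, t', r', hR, hR', intertwines_t, intertwines_r⟩ :=
    exists_intertwines_of_isFunctionOf (U := .id ℂ E) hS hS
      (pcomp_toP_le_iff.mpr fun _ _ hxy => hxy) h h'
  obtain rfl : t = t' := Adj.ext intertwines_t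
  obtain rfl : r = r' := Adj.ext intertwines_r
  refine LinearPMap.eq_of_eq_graph (Submodule.ext fun ⟨x, y⟩ => ?_)
  rw [hR.mem_graph_iff, hR'.mem_graph_iff]

theorem IsNormal.existsUnique_isFunctionOf (hS : IsNormal A S) (hG : IsWeaklyCompatible A S G)
    (f : C(G, ℂ)) : ∃! R : E →ₗ.[ℂ] E, IsFunctionOf A S f R :=
  let ⟨R, hR⟩ := hS.exists_isFunctionOf hG f
  ⟨R, hR, fun _ hR' => hR'.unique hS hR⟩

end Intertwining

end

end HilbertModule

open HilbertModule in
theorem mainTheorem1_general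
    {A : Type*} [NonUnitalCStarAlgebra A] [PartialOrder A] [StarOrderedRing A]
    {E F : Type*}
    [NormedAddCommGroup E] [NormedSpace ℂ E] [SMul A E] [CStarModule A E] [CompleteSpace E]
    [NormedAddCommGroup F] [NormedSpace ℂ F] [SMul A F] [CStarModule A F] [CompleteSpace F]
    (U : E →L[ℂ] F) (S : E →ₗ.[ℂ] E) (T : F →ₗ.[ℂ] F)
    (hS : IsNormal A S) (hT : IsNormal A T)
    (hUST : pcomp (toP U) S ≤ pcomp T (toP U)) :
    pcomp (toP U) (adjoint A S) ≤ pcomp (adjoint A T) (toP U) ∧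
    ∀ G : Set ℂ, IsWeaklyCompatible A S G → IsWeaklyCompatible A T G → ∀ f : C(G, ℂ),
      (∃! fS : E →ₗ.[ℂ] E, IsFunctionOf A S f fS) ∧
      (∃! fT : F →ₗ.[ℂ] F, IsFunctionOf A T f fT) ∧
      ∀ (fS : E →ₗ.[ℂ] E) (fT : F →ₗ.[ℂ] F),
        IsFunctionOf A S f fS → IsFunctionOf A T f fT →
          pcomp (toP U) fS ≤ pcomp fT (toP U) ∧
          (Function.Bijective U → pcomp (toP U) fS = pcomp fT (toP U)) := by
  refine ⟨pcomp_adjoint_le hS hT hUST, fun G hGS hGT f =>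
    ⟨hS.existsUnique_isFunctionOf hGS f, hT.existsUnique_isFunctionOf hGT f,
      fun fS fT hfS hfT => ?_⟩⟩
  obtain ⟨t, r, t', r', hfS_pair, hfT_pair, ht, hr⟩ :=
    exists_intertwines_of_isFunctionOf hS hT hUST hfS hfT
  exact ⟨pcomp_le_of_intertwines hfS_pair hfT_pair ht hr,
    pcomp_eq_of_intertwines hfS_pair hfT_pair ht hr⟩

open HilbertModule in
theorem mainTheorem1
    {A : Type*} [NonUnitalCStarAlgebra A] [PartialOrder A] [StarOrderedRing A]
    {E F : Type*}
    [NormedAddCommGroup E] [NormedSpace ℂ E] [SMul A E] [CStarModule A E] [CompleteSpace E]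
    [NormedAddCommGroup F] [NormedSpace ℂ F] [SMul A F] [CStarModule A F] [CompleteSpace F]
    (U : E →L[ℂ] F) (S : E →ₗ.[ℂ] E) (T : F →ₗ.[ℂ] F)
    (hS : IsNormal A S) (hT : IsNormal A T)
    (hUST : pcomp (toP U) S ≤ pcomp T (toP U)) :
    pcomp (toP U) (adjoint A S) ≤ pcomp (adjoint A T) (toP U) ∧
    ∀ G : Set ℂ, IsCompatible A S G → IsCompatible A T G → ∀ f : C(G, ℂ),
      (∃! fS : E →ₗ.[ℂ] E, IsFunctionOf A S f fS) ∧
      (∃! fT : F →ₗ.[ℂ] F, IsFunctionOf A T f fT) ∧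
      ∀ (fS : E →ₗ.[ℂ] E) (fT : F →ₗ.[ℂ] F),
        IsFunctionOf A S f fS → IsFunctionOf A T f fT →
          pcomp (toP U) fS ≤ pcomp fT (toP U) ∧
          (IsUnitary A U → pcomp (toP U) fS = pcomp fT (toP U)) :=
  (mainTheorem1_general U S T hS hT hUST).imp_right fun h G hGS hGT f =>
    (h G hGS.2 hGT.2 f).imp_right <| And.imp_right fun h fS fT hfS hfT =>
      (h fS fT hfS hfT).imp_right fun eq hU => eq hU.bijective
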